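/- Let $Y_{\ell,m}$ ($\ell=0,2,4$, $-\ell\le m\le \ell$) be the real spherical harmonics of bands 0, 2, 4 on the unit sphere $S^2\subset\mathbb{R}^3$, orthonormal in $L^2(S^2)$. Write a vector of coefficients in this basis as $q=(q_0,q_2,q_4)\in\mathbb{R}\times\mathbb{R}^5\times\mathbb{R}^9=\mathbb{R}^{15}$. The odeco variety $\tilde F\subset\mathbb{R}^{15}$ is the set of coefficient vectors of the functions on $S^2$ given by the quartics $\sum_{i=1}^3\lambda_i(v_i^{\top}x)^4$ with $\lambda\in\mathbb{R}^3$ and $v_1,v_2,v_3\in\mathbb{R}^3$ orthonormal. The octahedral variety is the orbit $F=\rho(\mathrm{SO}(3))\,f_0\subset\mathbb{R}^9$ of the canonical frame $f_0=(0,0,0,0,\sqrt{7/12},0,0,0,\sqrt{5/12})^{\top}$, where $\rho$ is the representation of $\mathrm{SO}(3)$ on the fourth band by $(rf)(x)=f(r^{-1}x)$, in the basis $Y_{4,-4},\dots,Y_{4,4}$; the elements of $F$ are called octahedral frames. Put $c=3\sqrt{21}/4$. Then there are symmetric matrices $A_1,\dots,A_{27}\in\mathbb{R}^{15\times15}$ and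 $P_1,\dots,P_{15}\in\mathbb{R}^{10\times10}$ such that the following hold. 1. (27 quadrics.) $\tilde F=\{q\in\mathbb{R}^{15} : q^{\top}A_iq=0,\ i=1,\dots,27\}$. The equations are not redundant: $A_1,\dots,A_{27}$ form a basis of the space of all symmetric matrices $A$ with $q^{\top}Aq=0$ on $\tilde F$, and omitting any one equation enlarges the solution set. 2. (Slice.) $\{q\in\tilde F : q_2=0\}=\{t\,(c,0,f) : t\in\mathbb{R},\ f\in F\}$; that is, the slice consists of the scalar multiples of octahedral frames, indexed by $q_0=tc$. For a point $q$ of this slice, $\|q_4\|=1$ if and only if $|q_0|=c$. 3. (Octahedral variety as normalized slice.) $F=\{f\in\mathbb{R}^9 : (c,0,f)\in\tilde F\}$; that is, $F$ is the intersection of $\tilde F$ with the affine subspace $q_2=0$, $q_0=c$, on which $\|q_4\|=1$. 4. (15 quadratic equations.) $$F=\Big\{f\in\mathbb{R}^9 : \begin{pmatrix}1\\ f\end{pmatrix}^{\top}P_i\begin{pmatrix}1\\ f\end{pmatrix}=0,\ i=1,\dots,15\Big\}.$$ The equations are not redundant: $P_1,\dots,P_{15}$ form a basis of the space of all symmetric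 $P$ whose equation holds on $F$, and omitting any one equation enlarges the solution set. They arise by reducing the equations of $\tilde F$: the span of the $P_i$ is the span of the matrices $S^{\top}A_iS$, $i=1,\dots,27$, where $S\in\mathbb{R}^{15\times10}$ is the matrix with $S(1,f)=(c,0,f)$ for all $f\in\mathbb{R}^9$. -/

import Mathlib

/-- Euclidean three-space. -/
abbrev E3 : Type := EuclideanSpace ℝ (Fin 3)

/-- The unit sphere `S²`. -/
abbrev unitSphere : Set E3 := Metric.sphere (0 : E3) 1

/-! ### Real spherical harmonics of bands 0, 2, 4

They are the restrictions to the unit sphere of the following homogeneous harmonic polynomials,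
normalized to be orthonormal in `L²(S²)`; within a band the order is `m = -ℓ, …, ℓ`. -/

/-- Band 0 (constant). -/
noncomputable def harm0 : ℝ := 1 / 2 * √(1 / Real.pi)

/-- Band 2, order `m = -2, -1, 0, 1, 2`. -/
noncomputable def harm2 (v : E3) : Fin 5 → ℝ :=
  let x := v 0
  let y := v 1
  let z := v 2
  ![1 / 2 * √(15 / Real.pi) * (x * y),
    1 / 2 * √(15 / Real.pi) * (y * z),
    1 / 4 * √(5 / Real.pi) * (2 * z ^ 2 - x ^ 2 - y ^ 2),
    1 / 2 * √(15 / Real.pi) * (x * z),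
    1 / 4 * √(15 / Real.pi) * (x ^ 2 - y ^ 2)]

/-- Band 4, order `m = -4, …, 4`. -/
noncomputable def harm4 (v : E3) : Fin 9 → ℝ :=
  let x := v 0
  let y := v 1
  let z := v 2
  let s := x ^ 2 + y ^ 2 + z ^ 2
  ![3 / 4 * √(35 / Real.pi) * (x * y * (x ^ 2 - y ^ 2)),
    3 / 4 * √(35 / (2 * Real.pi)) * (y * z * (3 * x ^ 2 - y ^ 2)),
    3 / 4 * √(5 / Real.pi) * (x * y * (7 * z ^ 2 - s)),
    3 / 4 * √(5 / (2 * Real.pi)) * (y * z * (7 * z ^ 2 - 3 * s)),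
    3 / 16 * √(1 / Real.pi) * (35 * z ^ 4 - 30 * z ^ 2 * s + 3 * s ^ 2),
    3 / 4 * √(5 / (2 * Real.pi)) * (x * z * (7 * z ^ 2 - 3 * s)),
    3 / 8 * √(5 / Real.pi) * ((x ^ 2 - y ^ 2) * (7 * z ^ 2 - s)),
    3 / 4 * √(35 / (2 * Real.pi)) * (x * z * (x ^ 2 - 3 * y ^ 2)),
    3 / 16 * √(35 / Real.pi) * (x ^ 4 - 6 * x ^ 2 * y ^ 2 + y ^ 4)]

/-! ### The octahedral variety -/

/-- The function on the sphere with band 4 coefficient vector `f`. -/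
noncomputable def band4Fun (f : EuclideanSpace ℝ (Fin 9)) (x : E3) : ℝ :=
  ∑ m, f m * harm4 x m

/-- The action of a rotation on a vector. -/
noncomputable def rotate (r : Matrix.specialOrthogonalGroup (Fin 3) ℝ) (x : E3) : E3 :=
  WithLp.toLp 2 ((r : Matrix (Fin 3) (Fin 3) ℝ).mulVec x.ofLp)

/-- `g = ρ(r) f`, where `ρ` is the representation of `SO(3)` on the fourth band: `g` is the
coefficient vector of the rotated function `x ↦ f(r⁻¹ x)` on the sphere. -/
def IsBand4Rotation (r : Matrix.specialOrthogonalGroup (Fin 3) ℝ)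
    (f g : EuclideanSpace ℝ (Fin 9)) : Prop :=
  ∀ x ∈ unitSphere, band4Fun g x = band4Fun f (rotate r⁻¹ x)

/-- The canonical octahedral frame. -/
noncomputable def canonicalFrame : EuclideanSpace ℝ (Fin 9) :=
  !₂[0, 0, 0, 0, √(7 / 12), 0, 0, 0, √(5 / 12)]

/-- The octahedral variety: the orbit of the canonical frame under `SO(3)`. -/
def octahedralVariety : Set (EuclideanSpace ℝ (Fin 9)) :=
  {f | ∃ r : Matrix.specialOrthogonalGroup (Fin 3) ℝ, IsBand4Rotation r canonicalFrame f}

/-! ### The odeco variety of ternary quartics -/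

/-- A ternary quartic `∑ᵢ λᵢ (vᵢᵀ x)⁴` with orthonormal `v₁, v₂, v₃`. -/
def IsOdecoQuartic (p : MvPolynomial (Fin 3) ℝ) : Prop :=
  ∃ (lam : Fin 3 → ℝ) (v : Fin 3 → E3), Orthonormal ℝ v ∧
    p = ∑ i, MvPolynomial.C (lam i) *
      (∑ j, MvPolynomial.C (v i j) * MvPolynomial.X j) ^ 4

/-- The 15 indices of the even spherical harmonics: bands 0, 2 and 4. -/
abbrev EvenIdx : Type := Fin 1 ⊕ Fin 5 ⊕ Fin 9

/-- The coefficient vector `(q₀, q₂, q₄)`. -/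
noncomputable def evenCoeffs (q0 : ℝ) (q2 : EuclideanSpace ℝ (Fin 5))
    (q4 : EuclideanSpace ℝ (Fin 9)) : EuclideanSpace ℝ EvenIdx :=
  WithLp.toLp 2 (Sum.elim (fun _ => q0) (Sum.elim q2.ofLp q4.ofLp))

/-- The band 0 coefficient. -/
def band0 (q : EuclideanSpace ℝ EvenIdx) : ℝ := q (Sum.inl 0)

/-- The band 2 coefficients. -/
def band2 (q : EuclideanSpace ℝ EvenIdx) : EuclideanSpace ℝ (Fin 5) :=
  WithLp.toLp 2 fun m => q (Sum.inr (Sum.inl m))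

/-- The band 4 coefficients. -/
def band4 (q : EuclideanSpace ℝ EvenIdx) : EuclideanSpace ℝ (Fin 9) :=
  WithLp.toLp 2 fun m => q (Sum.inr (Sum.inr m))

/-- The function on the sphere with even spherical harmonic coefficients `q`. -/
noncomputable def evenFun (q : EuclideanSpace ℝ EvenIdx) (x : E3) : ℝ :=
  band0 q * harm0 + ∑ m, band2 q m * harm2 x m + ∑ m, band4 q m * harm4 x m

/-- The odeco variety in the basis of even spherical harmonics: the coefficient vectors of
the odeco quartics, as functions on the sphere. -/
def odecoVariety : Set (EuclideanSpace ℝ EvenIdx) :=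
  {q | ∃ p : MvPolynomial (Fin 3) ℝ, IsOdecoQuartic p ∧
    ∀ x ∈ unitSphere, evenFun q x = MvPolynomial.eval x.ofLp p}

/-! ### Quadratic equations -/

/-- The quadratic form `qᵀ A q`. -/
def quad {ι : Type} [Fintype ι] (A : Matrix ι ι ℝ) (q : ι → ℝ) : ℝ :=
  dotProduct q (A.mulVec q)

/-- The vector `(1, f)`. -/
def withOne (f : EuclideanSpace ℝ (Fin 9)) : Fin 1 ⊕ Fin 9 → ℝ := Sum.elim (fun _ => 1) f.ofLp

/-- The value of `q₀` on the normalized slice. -/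
noncomputable def sliceConst : ℝ := 3 * √21 / 4

/-- The matrix taking `(1, f)` to the point `(sliceConst, 0, f)` of the normalized slice. -/
noncomputable def sliceMatrix : Matrix EvenIdx (Fin 1 ⊕ Fin 9) ℝ :=
  Matrix.of fun
    | Sum.inl _, Sum.inl _ => sliceConst
    | Sum.inr (Sum.inr m), Sum.inr n => if m = n then 1 else 0
    | _, _ => 0

/-- The quadratic equations with symmetric matrices `A i` cut out the subset `V` of the space `X`
(whose points enter the equations through the vectors `φ x`): `V` is their common zero set, the
equations are a basis of the space of all such equations that hold on `V`, and
omitting any one of them enlarges the zero set. -/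
structure CutOutIrredundantly {ι κ X : Type} [Fintype ι] (φ : X → ι → ℝ)
    (A : κ → Matrix ι ι ℝ) (V : Set X) : Prop where
  isSymm : ∀ i, (A i).IsSymm
  zeroSet : V = {x | ∀ i, quad (A i) (φ x) = 0}
  linearIndependent : LinearIndependent ℝ A
  spans : ∀ B : Matrix ι ι ℝ, B.IsSymm → (∀ x ∈ V, quad B (φ x) = 0) →
    B ∈ Submodule.span ℝ (Set.range A)
  irredundant : ∀ i, ∃ x, x ∉ V ∧ ∀ j, j ≠ i → quad (A j) (φ x) = 0

open Module

/-! ### Cutting out sets by quadratic equations -/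

section QuadraticForms

variable {ι κ X : Type} [Fintype ι] [Fintype κ]

theorem quad_eq_sum (A : Matrix ι ι ℝ) (q : ι → ℝ) :
    quad A q = ∑ i, ∑ j, A i j * (q i * q j) := by
  simp only [quad, dotProduct, Matrix.mulVec, Finset.mul_sum]
  exact Finset.sum_congr rfl fun i _ => Finset.sum_congr rfl fun j _ => by ring

theorem quad_transpose_mul_mul (S : Matrix ι κ ℝ) (A : Matrix ι ι ℝ) (q : κ → ℝ) :
    quad (S.transpose * A * S) q = quad A (S.mulVec q) := by
  simp only [quad, ← Matrix.mulVec_mulVec, Matrix.dotProduct_mulVec, Matrix.vecMul_transpose]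

/-- The value of a quadratic form at a vector, as a linear functional of the matrix. -/
def quadAt (q : ι → ℝ) : Matrix ι ι ℝ →ₗ[ℝ] ℝ where
  toFun A := quad A q
  map_add' A B := by simp [quad, Matrix.add_mulVec]
  map_smul' c A := by simp [quad, Matrix.smul_mulVec]

@[simp] theorem quadAt_apply (q : ι → ℝ) (A : Matrix ι ι ℝ) : quadAt q A = quad A q := rfl

/-- The symmetric matrices whose quadratic forms vanish on `V`. -/
def vanishingForms (φ : X → ι → ℝ) (V : Set X) : Submodule ℝ (Matrix ι ι ℝ) where
  carrier := {B | B.IsSymm ∧ ∀ x ∈ V, quad B (φ x) = 0}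
  zero_mem' := ⟨Matrix.isSymm_zero, fun x _ => (quadAt (φ x)).map_zero⟩
  add_mem' {A B} hA hB := ⟨hA.1.add hB.1, fun x hx => by
    rw [← quadAt_apply, map_add, quadAt_apply, quadAt_apply, hA.2 x hx, hB.2 x hx, add_zero]⟩
  smul_mem' c A hA := ⟨hA.1.smul c, fun x hx => by
    rw [← quadAt_apply, map_smul, quadAt_apply, hA.2 x hx, smul_zero]⟩

theorem quad_add (A : Matrix ι ι ℝ) (hA : A.IsSymm) (p q : ι → ℝ) :
    quad A (p + q) = quad A p + 2 * dotProduct p (A.mulVec q) + quad A q := by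
  have h : dotProduct q (A.mulVec p) = dotProduct p (A.mulVec q) := by
    rw [Matrix.dotProduct_mulVec, ← Matrix.mulVec_transpose, hA.eq, dotProduct_comm]
  simp only [quad, Matrix.mulVec_add, add_dotProduct, dotProduct_add, h]
  ring

theorem eq_zero_of_quad_eq_zero [DecidableEq ι] {A : Matrix ι ι ℝ} (hA : A.IsSymm)
    (h : ∀ q, quad A q = 0) : A = 0 := by
  ext i j
  have h1 := quad_add A hA (Pi.single i 1) (Pi.single j 1)
  rw [h, h, h] at h1
  simpa using h1

/-- The quadratic forms that vanish on `V` have a basis that is dual to evaluation at suitable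
points, which makes every one of them irredundant. -/
theorem exists_cutOutIrredundantly {φ : X → ι → ℝ} {V : Set X} {n : ℕ}
    (hn : finrank ℝ (vanishingForms φ V) = n)
    (hV : ∀ x, (∀ B ∈ vanishingForms φ V, quad B (φ x) = 0) → x ∈ V)
    (hφ : ∀ B : Matrix ι ι ℝ, B.IsSymm → (∀ x, quad B (φ x) = 0) → B = 0) :
    ∃ A : Fin n → Matrix ι ι ℝ, CutOutIrredundantly φ A V ∧
      Submodule.span ℝ (Set.range A) = vanishingForms φ V := by
  set W := vanishingForms φ V with hW
  let ev : X → Dual ℝ W := fun x => (quadAt (φ x)).comp W.subtype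
  have hspan : Submodule.span ℝ (Set.range ev) = ⊤ := by
    rw [← Subspace.dualCoannihilator_dualAnnihilator_eq (W := Submodule.span ℝ (Set.range ev)),
      show (Submodule.span ℝ (Set.range ev)).dualCoannihilator = ⊥ from ?_,
      Submodule.dualAnnihilator_bot]
    refine (Submodule.eq_bot_iff _).2 fun B hB => ?_
    rw [Submodule.mem_dualCoannihilator] at hB
    exact Subtype.ext (hφ B.1 B.2.1 fun x => hB (ev x) (Submodule.subset_span ⟨x, rfl⟩))
  obtain ⟨f, hf, hfspan, hfli⟩ := Submodule.exists_fun_fin_finrank_span_eq ℝ (Set.range ev)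
  have hcard : finrank ℝ (Submodule.span ℝ (Set.range ev)) = n := by
    rw [hspan, finrank_top, Subspace.dual_finrank_eq, hn]
  obtain ⟨f, hf, hfspan, hfli⟩ : ∃ f : Fin n → Dual ℝ W, (∀ i, f i ∈ Set.range ev) ∧
      Submodule.span ℝ (Set.range f) = Submodule.span ℝ (Set.range ev) ∧
      LinearIndependent ℝ f := hcard ▸ ⟨f, hf, hfspan, hfli⟩
  choose x hx using hf
  let b : Basis (Fin n) ℝ (Dual ℝ W) := Basis.mk hfli (by rw [hfspan, hspan])
  let a : Basis (Fin n) ℝ W := b.dualBasis.map (evalEquiv ℝ W).symm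
  have hdual : ∀ i j, quad (a i : Matrix ι ι ℝ) (φ (x j)) = if i = j then 1 else 0 := by
    intro i j
    have h1 : quad (a i : Matrix ι ι ℝ) (φ (x j)) = b j (a i) := by
      simp only [b, Basis.mk_apply, ← hx]
      rfl
    rw [h1]
    simp [a, Finsupp.single_apply, eq_comm]
  have hrange : Submodule.span ℝ (Set.range fun i => (a i : Matrix ι ι ℝ)) = W := by
    have h := congrArg (Submodule.map W.subtype) a.span_eq
    rwa [Submodule.map_span, ← Set.range_comp, Submodule.map_top, Submodule.range_subtype] at h
  refine ⟨fun i => a i, ⟨fun i => (a i).2.1, ?_, ?_, ?_, ?_⟩, hrange⟩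
  · ext y
    refine ⟨fun hy i => (a i).2.2 y hy, fun hy => hV y fun B hB => ?_⟩
    rw [← hrange] at hB
    have hle : Submodule.span ℝ (Set.range fun i => (a i : Matrix ι ι ℝ)) ≤
        LinearMap.ker (quadAt (φ y)) :=
      Submodule.span_le.2 (by rintro _ ⟨i, rfl⟩; exact hy i)
    exact hle hB
  · exact a.linearIndependent.map' W.subtype W.ker_subtype
  · intro B hB hB'
    rw [hrange]
    exact ⟨hB, hB'⟩
  · intro i
    refine ⟨x i, fun hxV => ?_, fun j hji => by simp [hdual, hji]⟩
    have h := (a i).2.2 (x i) hxV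
    simp [hdual] at h

/-- An upper bound for the dimension of a space of vanishing quadratic forms: in suitable
coordinates, the forms are determined by `n` of their coefficients. -/
theorem finrank_vanishingForms_le [DecidableEq κ] (e : (κ → ℝ) ≃ₗ[ℝ] (ι → ℝ)) {n : ℕ}
    {φ : X → ι → ℝ} {V : Set X} {Y : Type} {ψ : Y → κ → ℝ} {U : Set Y}
    (h : ∀ y ∈ U, ∃ x ∈ V, φ x = e (ψ y)) (pos : Fin n → κ × κ)
    (hpos : ∀ B ∈ vanishingForms ψ U, (∀ i, B (pos i).1 (pos i).2 = 0) → B = 0) :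
    finrank ℝ (vanishingForms φ V) ≤ n := by
  classical
  let M := LinearMap.toMatrix' (e : (κ → ℝ) →ₗ[ℝ] (ι → ℝ))
  have hM : ∀ A p, quad (M.transpose * A * M) p = quad A (e p) := fun A p => by
    rw [quad_transpose_mul_mul, LinearMap.toMatrix'_mulVec]
    simp
  let F : vanishingForms φ V →ₗ[ℝ] (Fin n → ℝ) :=
    { toFun := fun A i => (M.transpose * A.1 * M) (pos i).1 (pos i).2
      map_add' := fun A B => by ext; simp [Matrix.mul_add, Matrix.add_mul]
      map_smul' := fun c A => by ext; simp }
  have hF : Function.Injective F := by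
    rw [← LinearMap.ker_eq_bot, Submodule.eq_bot_iff]
    intro A hA
    have h0 : M.transpose * A.1 * M = 0 := by
      refine hpos _ ⟨?_, fun y hy => ?_⟩ fun i => congrFun hA i
      · simp [Matrix.IsSymm, Matrix.transpose_mul, A.2.1.eq, Matrix.mul_assoc]
      · obtain ⟨x, hx, hxy⟩ := h y hy
        rw [hM, ← hxy, A.2.2 x hx]
    refine Subtype.ext (eq_zero_of_quad_eq_zero A.2.1 fun q => ?_)
    rw [← e.apply_symm_apply q, ← hM, h0]
    simp [quad]
  simpa using LinearMap.finrank_le_finrank_of_injective hF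

/-- Quadratic forms whose values at suitable vectors are triangular are linearly independent. -/
theorem linearIndependent_of_quad_triangular {n : ℕ} (A : Fin n → Matrix ι ι ℝ)
    (q : Fin n → ι → ℝ) (h0 : ∀ i j, i < j → quad (A i) (q j) = 0)
    (h1 : ∀ i, quad (A i) (q i) ≠ 0) : LinearIndependent ℝ A := by
  let M : Matrix (Fin n) (Fin n) ℝ := Matrix.of fun i j => quad (A i) (q j)
  have hM : M.IsLowerTriangular := fun i j hij => h0 i j hij
  have hdet : IsUnit M := by
    rw [Matrix.isUnit_iff_isUnit_det, Matrix.det_of_isLowerTriangular M hM]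
    exact (Finset.prod_ne_zero_iff.2 fun i _ => h1 i).isUnit
  have hli := Matrix.linearIndependent_rows_of_isUnit hdet
  exact LinearIndependent.of_comp (LinearMap.pi fun j => quadAt (q j)) hli

/-- Vanishing quadratic forms can be transported along a linear change of coordinates. -/
theorem exists_vanishingForms_comp [DecidableEq ι] [DecidableEq κ] (e : (κ → ℝ) ≃ₗ[ℝ] (ι → ℝ))
    {Y : Type} {φ : X → ι → ℝ} {V : Set X} {ψ : Y → κ → ℝ} {U : Set Y}
    (h : ∀ x ∈ V, ∃ y ∈ U, φ x = e (ψ y)) {B : Matrix κ κ ℝ} (hB : B ∈ vanishingForms ψ U) :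
    ∃ A ∈ vanishingForms φ V, ∀ p, quad A (e p) = quad B p := by
  let M := LinearMap.toMatrix' (e.symm : (ι → ℝ) →ₗ[ℝ] (κ → ℝ))
  have hM : ∀ p, quad (M.transpose * B * M) (e p) = quad B p := fun p => by
    rw [quad_transpose_mul_mul, LinearMap.toMatrix'_mulVec]
    simp
  refine ⟨M.transpose * B * M, ⟨?_, ?_⟩, hM⟩
  · simp [Matrix.IsSymm, Matrix.transpose_mul, hB.1.eq, Matrix.mul_assoc]
  · intro x hx
    obtain ⟨y, hy, hxy⟩ := h x hx
    rw [hxy, hM, hB.2 y hy]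

end QuadraticForms

/-! ### Ternary quartics in tensor coordinates -/

/-- The position of the monomial `x_a x_b x_c x_d` in the list
`x⁴, y⁴, z⁴, y²z², x²z², x²y², x³y, xy³, xyz², x³z, xz³, xy²z, y³z, yz³, x²yz`. -/
def quarticIdx (a b c d : Fin 3) : Fin 15 :=
  let w : Fin 3 → ℕ := ![0, 1, 5]
  match w a + w b + w c + w d with
  | 0 => 0 | 1 => 6 | 2 => 5 | 3 => 7 | 4 => 1 | 5 => 9 | 6 => 14 | 7 => 11 | 8 => 12
  | 10 => 4 | 11 => 8 | 12 => 3 | 15 => 10 | 16 => 13 | _ => 2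

/-- The quartic monomials in the coordinates of a vector, in the order of `quarticIdx`. -/
def quarticMonomials {R : Type} [CommRing R] (v : Fin 3 → R) : Fin 15 → R :=
  ![v 0 ^ 4, v 1 ^ 4, v 2 ^ 4, v 1 ^ 2 * v 2 ^ 2, v 0 ^ 2 * v 2 ^ 2, v 0 ^ 2 * v 1 ^ 2,
    v 0 ^ 3 * v 1, v 0 * v 1 ^ 3, v 0 * v 1 * v 2 ^ 2, v 0 ^ 3 * v 2, v 0 * v 2 ^ 3,
    v 0 * v 1 ^ 2 * v 2, v 1 ^ 3 * v 2, v 1 * v 2 ^ 3, v 0 ^ 2 * v 1 * v 2]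

theorem quarticMonomials_quarticIdx {R : Type} [CommRing R] (v : Fin 3 → R) (a b c d : Fin 3) :
    quarticMonomials v (quarticIdx a b c d) = v a * v b * v c * v d := by
  fin_cases a <;> fin_cases b <;> fin_cases c <;> fin_cases d <;>
    simp [quarticMonomials, quarticIdx] <;> try ring

/-- The value at `x` of the quartic whose symmetric tensor has entries `T`. -/
def quarticEval (T : Fin 15 → ℝ) (x : Fin 3 → ℝ) : ℝ :=
  T 0 * x 0 ^ 4 + T 1 * x 1 ^ 4 + T 2 * x 2 ^ 4 + 6 * T 3 * (x 1 ^ 2 * x 2 ^ 2) +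
    6 * T 4 * (x 0 ^ 2 * x 2 ^ 2) + 6 * T 5 * (x 0 ^ 2 * x 1 ^ 2) + 4 * T 6 * (x 0 ^ 3 * x 1) +
    4 * T 7 * (x 0 * x 1 ^ 3) + 12 * T 8 * (x 0 * x 1 * x 2 ^ 2) + 4 * T 9 * (x 0 ^ 3 * x 2) +
    4 * T 10 * (x 0 * x 2 ^ 3) + 12 * T 11 * (x 0 * x 1 ^ 2 * x 2) + 4 * T 12 * (x 1 ^ 3 * x 2) +
    4 * T 13 * (x 1 * x 2 ^ 3) + 12 * T 14 * (x 0 ^ 2 * x 1 * x 2)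

theorem quarticEval_sub (S T : Fin 15 → ℝ) (x : Fin 3 → ℝ) :
    quarticEval (S - T) x = quarticEval S x - quarticEval T x := by
  simp only [quarticEval, Pi.sub_apply]
  ring

theorem quarticEval_smul (T : Fin 15 → ℝ) (c : ℝ) (x : Fin 3 → ℝ) :
    quarticEval T (c • x) = c ^ 4 * quarticEval T x := by
  simp only [quarticEval, Pi.smul_apply, smul_eq_mul]
  ring

theorem quarticEval_quarticMonomials (v x : Fin 3 → ℝ) :
    quarticEval (quarticMonomials v) x = (∑ j, v j * x j) ^ 4 := by
  simp only [quarticEval, quarticMonomials, Fin.sum_univ_three]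
  simp
  ring

/-- A quartic that vanishes on the unit sphere is zero. -/
theorem eq_zero_of_quarticEval_eq_zero {T : Fin 15 → ℝ}
    (h : ∀ x ∈ unitSphere, quarticEval T x.ofLp = 0) : T = 0 := by
  have h' : ∀ x : Fin 3 → ℝ, quarticEval T x = 0 := by
    intro x
    rcases eq_or_ne (WithLp.toLp 2 x) (0 : E3) with hx | hx
    · have : x = 0 := by simpa using congrArg WithLp.ofLp hx
      simp [this, quarticEval]
    · have hn : ‖(WithLp.toLp 2 x : E3)‖ ≠ 0 := norm_ne_zero_iff.2 hx
      have h1 := h (‖(WithLp.toLp 2 x : E3)‖⁻¹ • WithLp.toLp 2 x) (by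
        simp [norm_smul, inv_mul_cancel₀ hn])
      rw [WithLp.ofLp_smul, quarticEval_smul] at h1
      simpa [hn] using h1
  have e := fun a b c => h' ![a, b, c]
  simp only [quarticEval] at e
  have p1 := e 1 0 0
  have p2 := e 0 1 0
  have p3 := e 0 0 1
  have p4 := e 1 1 0
  have p5 := e 1 (-1) 0
  have p6 := e 1 2 0
  have p7 := e 1 0 1
  have p8 := e 1 0 (-1)
  have p9 := e 1 0 2
  have p10 := e 0 1 1
  have p11 := e 0 1 (-1)
  have p12 := e 0 1 2
  have p13 := e 1 1 1
  have p14 := e 1 1 (-1)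
  have p15 := e 1 (-1) 1
  simp at p1 p2 p3 p4 p5 p6 p7 p8 p9 p10 p11 p12 p13 p14 p15
  rw [p1, p2] at p4 p5 p6
  rw [p1, p3] at p7 p8 p9
  rw [p2, p3] at p10 p11 p12
  have q5 : T 5 = 0 := by linarith
  have q6 : T 6 = 0 := by linarith
  have q7 : T 7 = 0 := by linarith
  have q4 : T 4 = 0 := by linarith
  have q9 : T 9 = 0 := by linarith
  have q10 : T 10 = 0 := by linarith
  have q3 : T 3 = 0 := by linarith
  have q12 : T 12 = 0 := by linarith
  have q13 : T 13 = 0 := by linarith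
  rw [p1, p2, p3, q3, q4, q5, q6, q7, q9, q10, q12, q13] at p13 p14 p15
  have q8 : T 8 = 0 := by linarith
  have q11 : T 11 = 0 := by linarith
  have q14 : T 14 = 0 := by linarith
  ext i
  fin_cases i <;> assumption

/-! ### From tensor coordinates to spherical harmonic coefficients -/

/-- The band 0 coefficient of a quartic. -/
noncomputable def quarticBand0 (T : Fin 15 → ℝ) : ℝ :=
  2 * √Real.pi / 5 * (T 0 + T 1 + T 2 + 2 * T 3 + 2 * T 4 + 2 * T 5)

/-- The band 2 coefficients of a quartic. -/
noncomputable def quarticBand2 (T : Fin 15 → ℝ) : Fin 5 → ℝ :=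
  ![16 * Real.pi / 35 * (1 / 2 * √(15 / Real.pi)) * (T 6 + T 7 + T 8),
    16 * Real.pi / 35 * (1 / 2 * √(15 / Real.pi)) * (T 14 + T 12 + T 13),
    16 * Real.pi / 35 * (1 / 4 * √(5 / Real.pi)) *
      (2 * (T 4 + T 3 + T 2) - (T 0 + T 5 + T 4) - (T 5 + T 1 + T 3)),
    16 * Real.pi / 35 * (1 / 2 * √(15 / Real.pi)) * (T 9 + T 10 + T 11),
    16 * Real.pi / 35 * (1 / 4 * √(15 / Real.pi)) * ((T 0 + T 5 + T 4) - (T 5 + T 1 + T 3))]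

/-- The band 4 coefficients of a quartic. -/
noncomputable def quarticBand4 (T : Fin 15 → ℝ) : Fin 9 → ℝ :=
  ![32 * Real.pi / 315 * (3 / 4 * √(35 / Real.pi)) * (T 6 - T 7),
    32 * Real.pi / 315 * (3 / 4 * √(35 / (2 * Real.pi))) * (3 * T 14 - T 12),
    32 * Real.pi / 315 * (3 / 4 * √(5 / Real.pi)) * (6 * T 8 - T 6 - T 7),
    32 * Real.pi / 315 * (3 / 4 * √(5 / (2 * Real.pi))) * (4 * T 13 - 3 * T 14 - 3 * T 12),
    32 * Real.pi / 315 * (3 / 16 * √(1 / Real.pi)) *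
      (8 * T 2 + 3 * T 0 + 3 * T 1 - 24 * T 4 - 24 * T 3 + 6 * T 5),
    32 * Real.pi / 315 * (3 / 4 * √(5 / (2 * Real.pi))) * (4 * T 10 - 3 * T 9 - 3 * T 11),
    32 * Real.pi / 315 * (3 / 8 * √(5 / Real.pi)) * (6 * T 4 - 6 * T 3 - T 0 + T 1),
    32 * Real.pi / 315 * (3 / 4 * √(35 / (2 * Real.pi))) * (T 9 - 3 * T 11),
    32 * Real.pi / 315 * (3 / 16 * √(35 / Real.pi)) * (T 0 - 6 * T 5 + T 1)]

/-- The even spherical harmonic coefficients of a quartic, as a linear map. -/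
noncomputable def quarticCoeffs : (Fin 15 → ℝ) →ₗ[ℝ] (EvenIdx → ℝ) where
  toFun T := Sum.elim (fun _ => quarticBand0 T) (Sum.elim (quarticBand2 T) (quarticBand4 T))
  map_add' S T := by
    ext (i | i | i)
    · simp only [Sum.elim_inl, Pi.add_apply, quarticBand0]
      ring
    · fin_cases i <;> simp [quarticBand2] <;> ring
    · fin_cases i <;> simp [quarticBand4] <;> ring
  map_smul' c T := by
    ext (i | i | i)
    · simp only [Sum.elim_inl, Pi.smul_apply, quarticBand0, smul_eq_mul, RingHom.id_apply]
      ring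
    · fin_cases i <;> simp [quarticBand2] <;> ring
    · fin_cases i <;> simp [quarticBand4] <;> ring

@[simp] theorem band0_quarticCoeffs (T : Fin 15 → ℝ) :
    band0 (WithLp.toLp 2 (quarticCoeffs T)) = quarticBand0 T := rfl

@[simp] theorem band2_quarticCoeffs (T : Fin 15 → ℝ) :
    band2 (WithLp.toLp 2 (quarticCoeffs T)) = WithLp.toLp 2 (quarticBand2 T) := rfl

@[simp] theorem band4_quarticCoeffs (T : Fin 15 → ℝ) :
    band4 (WithLp.toLp 2 (quarticCoeffs T)) = WithLp.toLp 2 (quarticBand4 T) := rfl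

theorem sum_sq_of_mem_unitSphere {x : E3} (hx : x ∈ unitSphere) :
    x 0 ^ 2 + x 1 ^ 2 + x 2 ^ 2 = 1 := by
  have h : ‖x‖ = 1 := by simpa using hx
  rw [EuclideanSpace.norm_eq, Real.sqrt_eq_one, Fin.sum_univ_three] at h
  simpa using h

theorem pi_mul_sqrt_div_pi (a : ℝ) (ha : 0 ≤ a) :
    Real.pi * (√(a / Real.pi) * √(a / Real.pi)) = a := by
  have := Real.pi_pos
  rw [Real.mul_self_sqrt (by positivity)]
  field_simp

theorem pi_mul_sqrt_div_two_pi (a : ℝ) (ha : 0 ≤ a) :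
    Real.pi * (√(a / (2 * Real.pi)) * √(a / (2 * Real.pi))) = a / 2 := by
  have := Real.pi_pos
  rw [Real.mul_self_sqrt (by positivity)]
  field_simp

theorem evenFun_quarticCoeffs (T : Fin 15 → ℝ) {x : E3} (hx : x ∈ unitSphere) :
    evenFun (WithLp.toLp 2 (quarticCoeffs T)) x = quarticEval T x.ofLp := by
  have hs := sum_sq_of_mem_unitSphere hx
  have hsq : √Real.pi * √(1 / Real.pi) = 1 := by
    rw [← Real.sqrt_mul Real.pi_pos.le, mul_one_div_cancel Real.pi_pos.ne', Real.sqrt_one]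
  have h1 := pi_mul_sqrt_div_pi 1 (by norm_num)
  have h5 := pi_mul_sqrt_div_pi 5 (by norm_num)
  have h15 := pi_mul_sqrt_div_pi 15 (by norm_num)
  have h35 := pi_mul_sqrt_div_pi 35 (by norm_num)
  have k5 := pi_mul_sqrt_div_two_pi 5 (by norm_num)
  have k35 := pi_mul_sqrt_div_two_pi 35 (by norm_num)
  have b0 : quarticBand0 T * harm0 =
      (T 0 + T 1 + T 2 + 2 * T 3 + 2 * T 4 + 2 * T 5) / 5 *
        (x 0 ^ 2 + x 1 ^ 2 + x 2 ^ 2) ^ 2 := by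
    simp only [quarticBand0, harm0, hs]
    linear_combination (T 0 + T 1 + T 2 + 2 * T 3 + 2 * T 4 + 2 * T 5) / 5 * hsq
  have b2 : ∑ m, quarticBand2 T m * harm2 x m =
      (12 / 7 * ((T 6 + T 7 + T 8) * (x 0 * x 1) + (T 14 + T 12 + T 13) * (x 1 * x 2) +
        (T 9 + T 10 + T 11) * (x 0 * x 2)) +
      1 / 7 * (2 * (T 4 + T 3 + T 2) - (T 0 + T 5 + T 4) - (T 5 + T 1 + T 3)) *
        (2 * x 2 ^ 2 - x 0 ^ 2 - x 1 ^ 2) +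
      3 / 7 * ((T 0 + T 5 + T 4) - (T 5 + T 1 + T 3)) * (x 0 ^ 2 - x 1 ^ 2)) *
      (x 0 ^ 2 + x 1 ^ 2 + x 2 ^ 2) := by
    rw [hs, mul_one]
    simp only [quarticBand2, harm2]
    generalize √(15 / Real.pi) = r at *
    generalize √(5 / Real.pi) = r' at *
    simp [Fin.sum_univ_succ]
    linear_combination (4 / 35 * ((T 6 + T 7 + T 8) * (x 0 * x 1) +
        (T 14 + T 12 + T 13) * (x 1 * x 2) + (T 9 + T 10 + T 11) * (x 0 * x 2)) +
      1 / 35 * ((T 0 + T 5 + T 4) - (T 5 + T 1 + T 3)) * (x 0 ^ 2 - x 1 ^ 2)) * h15 +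
      1 / 35 * (2 * (T 4 + T 3 + T 2) - (T 0 + T 5 + T 4) - (T 5 + T 1 + T 3)) *
        (2 * x 2 ^ 2 - x 0 ^ 2 - x 1 ^ 2) * h5
  have b4 : ∑ m, quarticBand4 T m * harm4 x m =
      2 * (T 6 - T 7) * (x 0 * x 1 * (x 0 ^ 2 - x 1 ^ 2)) +
      (3 * T 14 - T 12) * (x 1 * x 2 * (3 * x 0 ^ 2 - x 1 ^ 2)) +
      2 / 7 * (6 * T 8 - T 6 - T 7) *
        (x 0 * x 1 * (7 * x 2 ^ 2 - (x 0 ^ 2 + x 1 ^ 2 + x 2 ^ 2))) +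
      1 / 7 * (4 * T 13 - 3 * T 14 - 3 * T 12) *
        (x 1 * x 2 * (7 * x 2 ^ 2 - 3 * (x 0 ^ 2 + x 1 ^ 2 + x 2 ^ 2))) +
      1 / 280 * (8 * T 2 + 3 * T 0 + 3 * T 1 - 24 * T 4 - 24 * T 3 + 6 * T 5) *
        (35 * x 2 ^ 4 - 30 * x 2 ^ 2 * (x 0 ^ 2 + x 1 ^ 2 + x 2 ^ 2) +
          3 * (x 0 ^ 2 + x 1 ^ 2 + x 2 ^ 2) ^ 2) +
      1 / 7 * (4 * T 10 - 3 * T 9 - 3 * T 11) *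
        (x 0 * x 2 * (7 * x 2 ^ 2 - 3 * (x 0 ^ 2 + x 1 ^ 2 + x 2 ^ 2))) +
      1 / 14 * (6 * T 4 - 6 * T 3 - T 0 + T 1) *
        ((x 0 ^ 2 - x 1 ^ 2) * (7 * x 2 ^ 2 - (x 0 ^ 2 + x 1 ^ 2 + x 2 ^ 2))) +
      (T 9 - 3 * T 11) * (x 0 * x 2 * (x 0 ^ 2 - 3 * x 1 ^ 2)) +
      1 / 8 * (T 0 - 6 * T 5 + T 1) * (x 0 ^ 4 - 6 * x 0 ^ 2 * x 1 ^ 2 + x 1 ^ 4) := by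
    simp only [quarticBand4, harm4]
    generalize √(1 / Real.pi) = r1 at *
    generalize √(5 / Real.pi) = r5 at *
    generalize √(35 / Real.pi) = r35 at *
    generalize √(5 / (2 * Real.pi)) = s5 at *
    generalize √(35 / (2 * Real.pi)) = s35 at *
    simp only [hs]
    simp [Fin.sum_univ_succ]
    linear_combination
      (2 / 35 * (T 6 - T 7) * (x 0 * x 1 * (x 0 ^ 2 - x 1 ^ 2)) +
        1 / 280 * (T 0 - 6 * T 5 + T 1) * (x 0 ^ 4 - 6 * x 0 ^ 2 * x 1 ^ 2 + x 1 ^ 4)) * h35 +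
      (2 / 35 * (3 * T 14 - T 12) * (x 1 * x 2 * (3 * x 0 ^ 2 - x 1 ^ 2)) +
        2 / 35 * (T 9 - 3 * T 11) * (x 0 * x 2 * (x 0 ^ 2 - 3 * x 1 ^ 2))) * k35 +
      (2 / 35 * (6 * T 8 - T 6 - T 7) * (x 0 * x 1 * (7 * x 2 ^ 2 - 1)) +
        1 / 70 * (6 * T 4 - 6 * T 3 - T 0 + T 1) *
          ((x 0 ^ 2 - x 1 ^ 2) * (7 * x 2 ^ 2 - 1))) * h5 +
      (2 / 35 * (4 * T 13 - 3 * T 14 - 3 * T 12) * (x 1 * x 2 * (7 * x 2 ^ 2 - 3)) +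
        2 / 35 * (4 * T 10 - 3 * T 9 - 3 * T 11) * (x 0 * x 2 * (7 * x 2 ^ 2 - 3))) * k5 +
      1 / 280 * (8 * T 2 + 3 * T 0 + 3 * T 1 - 24 * T 4 - 24 * T 3 + 6 * T 5) *
        (35 * x 2 ^ 4 - 30 * x 2 ^ 2 + 3) * h1
  simp only [evenFun, band0_quarticCoeffs, band2_quarticCoeffs, band4_quarticCoeffs, b0, b2, b4,
    quarticEval]
  ring

theorem quarticCoeffs_injective : Function.Injective quarticCoeffs := by
  rw [← LinearMap.ker_eq_bot, Submodule.eq_bot_iff]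
  intro T hT
  refine eq_zero_of_quarticEval_eq_zero fun x hx => ?_
  rw [← evenFun_quarticCoeffs T hx, LinearMap.mem_ker.1 hT]
  simp [evenFun, band0, band2, band4]

/-- Quartics correspond to their even spherical harmonic coefficients. -/
noncomputable def quarticEquiv : (Fin 15 → ℝ) ≃ₗ[ℝ] (EvenIdx → ℝ) :=
  LinearEquiv.ofInjectiveOfFinrankEq quarticCoeffs quarticCoeffs_injective (by simp)

theorem quarticEquiv_apply (T : Fin 15 → ℝ) : quarticEquiv T = quarticCoeffs T := rfl

/-- The tensor coordinates of the odeco quartics. -/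
def odecoTensors : Set (Fin 15 → ℝ) :=
  {T | ∃ (lam : Fin 3 → ℝ) (v : Fin 3 → E3), Orthonormal ℝ v ∧
    T = ∑ i, lam i • quarticMonomials (v i).ofLp}

theorem quarticEval_sum_smul (lam : Fin 3 → ℝ) (v : Fin 3 → E3) (x : Fin 3 → ℝ) :
    quarticEval (∑ i, lam i • quarticMonomials (v i).ofLp) x =
      ∑ i, lam i * (∑ j, v i j * x j) ^ 4 := by
  have h : ∀ S T : Fin 15 → ℝ, quarticEval (S + T) x = quarticEval S x + quarticEval T x := by
    intro S T
    simp only [quarticEval, Pi.add_apply]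
    ring
  have h' : ∀ (c : ℝ) (T : Fin 15 → ℝ), quarticEval (c • T) x = c * quarticEval T x := by
    intro c T
    simp only [quarticEval, Pi.smul_apply, smul_eq_mul]
    ring
  simp only [Fin.sum_univ_three, h, h', quarticEval_quarticMonomials]

theorem mem_odecoVariety_iff (T : Fin 15 → ℝ) :
    WithLp.toLp 2 (quarticCoeffs T) ∈ odecoVariety ↔ T ∈ odecoTensors := by
  constructor
  · rintro ⟨p, ⟨lam, v, hv, rfl⟩, hp⟩
    refine ⟨lam, v, hv, ?_⟩
    rw [← sub_eq_zero]
    refine eq_zero_of_quarticEval_eq_zero fun x hx => ?_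
    rw [quarticEval_sub, ← evenFun_quarticCoeffs T hx, hp x hx, quarticEval_sum_smul]
    simp
  · rintro ⟨lam, v, hv, rfl⟩
    refine ⟨_, ⟨lam, v, hv, rfl⟩, fun x hx => ?_⟩
    rw [evenFun_quarticCoeffs _ hx, quarticEval_sum_smul]
    simp

/-! ### Odeco tensors are cut out by commutators -/

/-- A commuting family of symmetric operators has an orthonormal basis of eigenvectors. -/
theorem exists_orthonormalBasis_eigenvectors {E ι : Type} [NormedAddCommGroup E]
    [InnerProductSpace ℝ E] [FiniteDimensional ℝ E] {n : ℕ} (hn : finrank ℝ E = n)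
    (T : ι → E →ₗ[ℝ] E) (hT : ∀ i, (T i).IsSymmetric) (hC : ∀ i j, Commute (T i) (T j)) :
    ∃ v : OrthonormalBasis (Fin n) ℝ E, ∀ i r, ∃ c : ℝ, T i (v r) = c • v r := by
  classical
  have hI := LinearMap.IsSymmetric.directSum_isInternal_of_pairwise_commute hT
    fun i j _ => hC i j
  have hO := LinearMap.IsSymmetric.orthogonalFamily_iInf_eigenspaces hT
  have : Fintype {α : ι → ℝ // (⨅ j, End.eigenspace (T j) (α j)) ≠ ⊥} :=
    iSupIndep.fintypeNeBotOfFiniteDimensional hI.submodule_iSupIndep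
  have hI' := DirectSum.isInternal_ne_bot_iff.2 hI
  have hO' := hO.comp (γ := {α : ι → ℝ // (⨅ j, End.eigenspace (T j) (α j)) ≠ ⊥})
    Subtype.val_injective
  refine ⟨hI'.subordinateOrthonormalBasis hn hO', fun i r => ?_⟩
  have h := hI'.subordinateOrthonormalBasis_subordinate hn r hO'
  exact ⟨_, End.mem_eigenspace_iff.1 ((Submodule.mem_iInf _).1 h i)⟩

theorem orthonormal_iff_sum {v : Fin 3 → E3} :
    Orthonormal ℝ v ↔ ∀ i j, ∑ k, v i k * v j k = if i = j then 1 else 0 := by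
  rw [orthonormal_iff_ite]
  simp only [PiLp.inner_apply, RCLike.inner_apply, conj_trivial, mul_comm]

theorem Orthonormal.sum_mul_eq {v : Fin 3 → E3} (hv : Orthonormal ℝ v) (a b : Fin 3) :
    ∑ r, v r a * v r b = if a = b then 1 else 0 := by
  let M : Matrix (Fin 3) (Fin 3) ℝ := Matrix.of fun i k => v i k
  have h : M * M.transpose = 1 := by
    ext i j
    simpa [M, Matrix.mul_apply, Matrix.one_apply] using orthonormal_iff_sum.1 hv i j
  have h' : M.transpose * M = 1 := mul_eq_one_comm.1 h
  simpa [M, Matrix.mul_apply, Matrix.one_apply] using congrFun (congrFun h' a) b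

theorem quarticIdx_swap_left (a b c d : Fin 3) : quarticIdx a b c d = quarticIdx b a c d := by
  revert a b c d; decide

theorem quarticIdx_swap_middle (a b c d : Fin 3) : quarticIdx a b c d = quarticIdx a c b d := by
  revert a b c d; decide

theorem quarticIdx_swap_right (a b c d : Fin 3) : quarticIdx a b c d = quarticIdx a b d c := by
  revert a b c d; decide

theorem exists_quarticIdx (m : Fin 15) : ∃ a b c d, m = quarticIdx a b c d := by
  revert m; decide

/-- A symmetric tensor whose slices commute is orthogonally decomposable. -/
theorem mem_odecoTensors_of_commute {T : Fin 15 → ℝ}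
    (h : ∀ i j k l a b, ∑ s, T (quarticIdx i j a s) * T (quarticIdx k l s b) =
      ∑ s, T (quarticIdx k l a s) * T (quarticIdx i j s b)) : T ∈ odecoTensors := by
  let M : Fin 3 × Fin 3 → Matrix (Fin 3) (Fin 3) ℝ := fun p =>
    Matrix.of fun a b => T (quarticIdx p.1 p.2 a b)
  have hM : ∀ p, (Matrix.toEuclideanLin (M p)).IsSymmetric := fun p => by
    rw [Matrix.isSymmetric_toEuclideanLin_iff]
    ext a b
    simp [M, quarticIdx_swap_right p.1 p.2 a b]
  have hC : ∀ p q, Commute (Matrix.toEuclideanLin (M p)) (Matrix.toEuclideanLin (M q)) := by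
    intro p q
    have hpq : M p * M q = M q * M p := by
      ext a b
      simpa [M, Matrix.mul_apply] using h p.1 p.2 q.1 q.2 a b
    rw [Commute, SemiconjBy]
    ext1 x
    simp only [Module.End.mul_apply, Matrix.toLpLin_apply, Matrix.mulVec_mulVec, hpq]
  obtain ⟨v, hv⟩ := exists_orthonormalBasis_eigenvectors (n := 3) (by simp) _ hM hC
  choose D hD using hv
  have hD' : ∀ i j r a, ∑ b, T (quarticIdx i j a b) * v r b = D (i, j) r * v r a := by
    intro i j r a
    have h1 := congrArg (fun x : E3 => x a) (hD (i, j) r)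
    simpa [Matrix.toLpLin_apply, Matrix.mulVec, dotProduct, M] using h1
  have hnorm : ∀ r, ∑ a, v r a * v r a = 1 := fun r => by
    simpa using orthonormal_iff_sum.1 v.orthonormal r r
  have hsymm : ∀ i j r a, D (i, j) r * v r a = D (a, j) r * v r i := fun i j r a => by
    rw [← hD', ← hD']
    refine Finset.sum_congr rfl fun b _ => ?_
    rw [quarticIdx_swap_left i, quarticIdx_swap_middle j i, quarticIdx_swap_left j]
  have hcomm : ∀ i j r, D (i, j) r = D (j, i) r := fun i j r => by
    rw [← mul_one (D (i, j) r), ← hnorm r, ← mul_one (D (j, i) r), ← hnorm r, Finset.mul_sum,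
      Finset.mul_sum]
    refine Finset.sum_congr rfl fun a _ => ?_
    rw [← mul_assoc, ← hD', ← mul_assoc, ← hD']
    simp only [quarticIdx_swap_left i j]
  have hfac : ∀ i j r, D (i, j) r = (∑ a, D (a, j) r * v r a) * v r i := fun i j r => by
    rw [← mul_one (D (i, j) r), ← hnorm r, Finset.mul_sum, Finset.sum_mul]
    refine Finset.sum_congr rfl fun a _ => ?_
    rw [← mul_assoc, hsymm]
    ring
  refine ⟨fun r => ∑ a, (∑ c, D (c, a) r * v r c) * v r a, v, v.orthonormal, ?_⟩
  have hD2 : ∀ i j r, D (i, j) r =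
      (∑ a, (∑ c, D (c, a) r * v r c) * v r a) * v r i * v r j := fun i j r => by
    have h1 : ∀ a, D (a, j) r = (∑ c, D (c, a) r * v r c) * v r j := fun a => by
      rw [hcomm, hfac]
    rw [hfac i j r]
    simp only [fun a => h1 a]
    simp only [Finset.sum_mul]
    refine Finset.sum_congr rfl fun a _ => ?_
    refine Finset.sum_congr rfl fun c _ => ?_
    ring
  ext m
  obtain ⟨i, j, a, b, rfl⟩ := exists_quarticIdx m
  have h1 : T (quarticIdx i j a b) = ∑ c, T (quarticIdx i j a c) * ∑ r, v r c * v r b := by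
    simp [v.orthonormal.sum_mul_eq]
  rw [h1]
  simp only [Finset.mul_sum]
  rw [Finset.sum_comm, Finset.sum_apply]
  refine Finset.sum_congr rfl fun r _ => ?_
  simp only [← mul_assoc]
  rw [← Finset.sum_mul, hD', hD2, Pi.smul_apply, quarticMonomials_quarticIdx, smul_eq_mul]
  ring

/-! ### Quadratic forms vanishing on the odeco tensors -/

theorem inner_eq_sum_three (x y : E3) : inner ℝ x y = ∑ k, x k * y k := by
  simp only [PiLp.inner_apply, RCLike.inner_apply, conj_trivial, mul_comm]

theorem quarticMonomials_smul (c : ℝ) (v : Fin 3 → ℝ) :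
    quarticMonomials (c • v) = c ^ 4 • quarticMonomials v := by
  ext m
  fin_cases m <;> simp [quarticMonomials] <;> ring

theorem quarticMonomials_neg (v : Fin 3 → ℝ) : quarticMonomials (-v) = quarticMonomials v := by
  rw [← neg_one_smul ℝ v, quarticMonomials_smul]
  norm_num

theorem quarticMonomials_zero : quarticMonomials (0 : Fin 3 → ℝ) = 0 := by
  rw [← zero_smul ℝ (0 : Fin 3 → ℝ), quarticMonomials_smul]
  simp

/-- The fourth powers of nonzero orthogonal vectors are multiples of those of orthonormal ones. -/
theorem exists_orthonormal_of_orthogonal {v : Fin 3 → Fin 3 → ℝ} (h0 : ∀ i, v i ≠ 0)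
    (h : ∀ i j, i ≠ j → ∑ k, v i k * v j k = 0) :
    ∃ u : Fin 3 → E3, Orthonormal ℝ u ∧
      ∀ i, quarticMonomials (v i) = (∑ k, v i k ^ 2) ^ 2 • quarticMonomials (u i).ofLp := by
  have hn : ∀ i, ‖(WithLp.toLp 2 (v i) : E3)‖ ≠ 0 := fun i => by
    simpa using h0 i
  refine ⟨fun i => ‖(WithLp.toLp 2 (v i) : E3)‖⁻¹ • WithLp.toLp 2 (v i), ⟨fun i => ?_, ?_⟩,
    fun i => ?_⟩
  · rw [norm_smul, norm_inv, norm_norm, inv_mul_cancel₀ (hn i)]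
  · intro i j hij
    rw [real_inner_smul_left, real_inner_smul_right, inner_eq_sum_three]
    simp [h i j hij]
  · have hsq : ∑ k, v i k ^ 2 = ‖(WithLp.toLp 2 (v i) : E3)‖ ^ 2 := by
      simp [EuclideanSpace.norm_sq_eq]
    rw [WithLp.ofLp_smul, quarticMonomials_smul, smul_smul, hsq, ← pow_mul, inv_pow,
      mul_inv_cancel₀ (pow_ne_zero _ (hn i)), one_smul]

theorem smul_add_smul_mem_odecoTensors {v w : Fin 3 → ℝ} (hv : v ≠ 0) (hw : w ≠ 0)
    (h : ∑ k, v k * w k = 0) (c d : ℝ) :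
    c • quarticMonomials v + d • quarticMonomials w ∈ odecoTensors := by
  let u : Fin 3 → ℝ := ![v 1 * w 2 - v 2 * w 1, v 2 * w 0 - v 0 * w 2, v 0 * w 1 - v 1 * w 0]
  have hpos : ∀ x : Fin 3 → ℝ, x ≠ 0 → 0 < x 0 ^ 2 + x 1 ^ 2 + x 2 ^ 2 := fun x hx => by
    obtain ⟨k, hk⟩ := Function.ne_iff.1 hx
    have hk' : 0 < x k ^ 2 := by
      have : x k ≠ 0 := hk
      positivity
    fin_cases k <;> simp at hk' <;> nlinarith [sq_nonneg (x 0), sq_nonneg (x 1), sq_nonneg (x 2)]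
  have h' : v 0 * w 0 + v 1 * w 1 + v 2 * w 2 = 0 := by simpa [Fin.sum_univ_three] using h
  have hu : u ≠ 0 := fun hu => by
    have h1 : u 0 ^ 2 + u 1 ^ 2 + u 2 ^ 2 =
        (v 0 ^ 2 + v 1 ^ 2 + v 2 ^ 2) * (w 0 ^ 2 + w 1 ^ 2 + w 2 ^ 2) := by
      simp only [u, Matrix.cons_val]
      linear_combination (-(v 0 * w 0 + v 1 * w 1 + v 2 * w 2)) * h'
    have := mul_pos (hpos v hv) (hpos w hw)
    simp [hu] at h1
    rcases h1 with h1 | h1 <;> simp [h1] at this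
  obtain ⟨e, he, heq⟩ := exists_orthonormal_of_orthogonal (v := ![v, w, u])
    (fun i => by fin_cases i <;> simpa) (fun i j hij => by
      fin_cases i <;> fin_cases j <;> simp [Fin.sum_univ_three, u] at hij ⊢ <;>
        first | linear_combination h' | ring)
  refine ⟨![c * (∑ k, v k ^ 2) ^ 2, d * (∑ k, w k ^ 2) ^ 2, 0], e, he, ?_⟩
  have h0 := heq 0
  have h1 := heq 1
  simp only [Matrix.cons_val] at h0 h1
  simp only [Fin.sum_univ_three, Matrix.cons_val, zero_smul, add_zero, mul_smul] at h0 h1 ⊢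
  rw [← h0, ← h1]

theorem exists_orthogonal_ne_zero (v : Fin 3 → ℝ) :
    ∃ w : Fin 3 → ℝ, w ≠ 0 ∧ ∑ k, v k * w k = 0 := by
  by_cases h : v 0 = 0
  · exact ⟨![1, 0, 0], by simp, by simp [Fin.sum_univ_three, h]⟩
  · exact ⟨![-v 1, v 0, 0], by simp [h], by simp [Fin.sum_univ_three]; ring⟩

theorem quad_quarticMonomials_eq_zero {B : Matrix (Fin 15) (Fin 15) ℝ}
    (hB : B ∈ vanishingForms id odecoTensors) (v : Fin 3 → ℝ) :
    quad B (quarticMonomials v) = 0 := by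
  rcases eq_or_ne v 0 with rfl | hv
  · simp [quarticMonomials_zero, quad]
  · obtain ⟨w, hw, hvw⟩ := exists_orthogonal_ne_zero v
    simpa using hB.2 _ (smul_add_smul_mem_odecoTensors hv hw hvw 1 0)

/-- The bilinear form of `B` at two fourth powers. -/
def quarticPairing (B : Matrix (Fin 15) (Fin 15) ℝ) (v w : Fin 3 → ℝ) : ℝ :=
  ∑ m, ∑ n, B m n * (quarticMonomials v m * quarticMonomials w n)

theorem quarticPairing_self (B : Matrix (Fin 15) (Fin 15) ℝ) (v : Fin 3 → ℝ) :
    quarticPairing B v v = quad B (quarticMonomials v) := (quad_eq_sum _ _).symm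

theorem quarticPairing_eq_dotProduct (B : Matrix (Fin 15) (Fin 15) ℝ) (v w : Fin 3 → ℝ) :
    quarticPairing B v w = dotProduct (quarticMonomials v) (B.mulVec (quarticMonomials w)) := by
  simp only [quarticPairing, dotProduct, Matrix.mulVec, Finset.mul_sum]
  exact Finset.sum_congr rfl fun i _ => Finset.sum_congr rfl fun j _ => by ring

theorem quarticPairing_eq_zero {B : Matrix (Fin 15) (Fin 15) ℝ}
    (hB : B ∈ vanishingForms id odecoTensors) {v w : Fin 3 → ℝ}
    (h : ∑ k, v k * w k = 0 ∨ v = w) : quarticPairing B v w = 0 := by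
  rcases h with h | rfl
  · rcases eq_or_ne v 0 with rfl | hv
    · simp [quarticPairing, quarticMonomials_zero]
    rcases eq_or_ne w 0 with rfl | hw
    · simp [quarticPairing, quarticMonomials_zero]
    have h1 := hB.2 _ (smul_add_smul_mem_odecoTensors hv hw h 1 1)
    rw [one_smul, one_smul, id, quad_add B hB.1, quad_quarticMonomials_eq_zero hB,
      quad_quarticMonomials_eq_zero hB] at h1
    rw [quarticPairing_eq_dotProduct]
    linarith
  · rw [quarticPairing_self, quad_quarticMonomials_eq_zero hB]

/-- A symmetric matrix all of whose quartic pairings vanish at equal and at orthogonal vectors. -/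
structure IsOdecoForm (B : Matrix (Fin 15) (Fin 15) ℝ) : Prop where
  isSymm : B.IsSymm
  pairing : ∀ v w : Fin 3 → ℝ, (∑ k, v k * w k = 0 ∨ v = w) → quarticPairing B v w = 0

/-- The signs of the quartic monomials under reflection of a coordinate. -/
def reflectSign : Fin 3 → Fin 15 → ℤ :=
  ![![1, 1, 1, 1, 1, 1, -1, -1, -1, -1, -1, -1, 1, 1, 1],
    ![1, 1, 1, 1, 1, 1, -1, -1, -1, 1, 1, 1, -1, -1, -1],
    ![1, 1, 1, 1, 1, 1, 1, 1, 1, -1, -1, -1, -1, -1, -1]]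

/-- Reflection of a coordinate. -/
def reflectCoord (i : Fin 3) (v : Fin 3 → ℝ) : Fin 3 → ℝ := fun k => if k = i then -v k else v k

theorem quarticMonomials_reflectCoord (i : Fin 3) (v : Fin 3 → ℝ) (m : Fin 15) :
    quarticMonomials (reflectCoord i v) m = reflectSign i m * quarticMonomials v m := by
  fin_cases i <;> fin_cases m <;> simp [quarticMonomials, reflectSign, reflectCoord] <;>
    ring

theorem IsOdecoForm.sum_reflect {B : Matrix (Fin 15) (Fin 15) ℝ} (hB : IsOdecoForm B)
    (c : Fin 3 → ℤ) {v w : Fin 3 → ℝ} (h : ∑ k, v k * w k = 0 ∨ v = w) :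
    ∑ m, ∑ n, ((1 + ∑ i, c i * (reflectSign i m * reflectSign i n) : ℤ) : ℝ) *
      (B m n * (quarticMonomials v m * quarticMonomials w n)) = 0 := by
  have h0 := hB.pairing v w h
  have h1 : ∀ i, ∑ m, ∑ n, ((reflectSign i m * reflectSign i n : ℤ) : ℝ) *
      (B m n * (quarticMonomials v m * quarticMonomials w n)) = 0 := fun i => by
    have h2 := hB.pairing (reflectCoord i v) (reflectCoord i w) (h.imp (fun h => by
      rw [← h]
      refine Finset.sum_congr rfl fun k _ => ?_
      by_cases hk : k = i <;> simp [reflectCoord, hk]) fun h => by rw [h])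
    rw [← h2]
    simp only [quarticPairing, quarticMonomials_reflectCoord]
    push_cast
    exact Finset.sum_congr rfl fun m _ => Finset.sum_congr rfl fun n _ => by ring
  have h3 : ∀ m n, ((1 + ∑ i, c i * (reflectSign i m * reflectSign i n) : ℤ) : ℝ) *
      (B m n * (quarticMonomials v m * quarticMonomials w n)) =
      B m n * (quarticMonomials v m * quarticMonomials w n) +
      ∑ i, (c i : ℝ) * (((reflectSign i m * reflectSign i n : ℤ) : ℝ) *
        (B m n * (quarticMonomials v m * quarticMonomials w n))) := fun m n => by
    push_cast
    rw [add_mul, one_mul, Finset.sum_mul]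
    congr 1
    exact Finset.sum_congr rfl fun i _ => by ring
  simp only [h3, Finset.sum_add_distrib]
  rw [← quarticPairing, h0, zero_add]
  have h4 : ∀ m, ∑ n, ∑ i, (c i : ℝ) * (((reflectSign i m * reflectSign i n : ℤ) : ℝ) *
        (B m n * (quarticMonomials v m * quarticMonomials w n))) =
      ∑ i, (c i : ℝ) * ∑ n, (((reflectSign i m * reflectSign i n : ℤ) : ℝ) *
        (B m n * (quarticMonomials v m * quarticMonomials w n))) := fun m => by
    rw [Finset.sum_comm]
    simp only [Finset.mul_sum]
  simp only [h4]
  rw [Finset.sum_comm]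
  refine Finset.sum_eq_zero fun i _ => ?_
  rw [← Finset.mul_sum, h1, mul_zero]

/-! ### The coefficients of odeco forms -/

set_option maxHeartbeats 2000000 in
/-- The equations for the coefficients of an odeco form of parity `xy`, solved by evaluation. -/
theorem xyBlock_eq_zero
    (b0_6 b1_6 b1_7 b2_6 b2_7 b3_6 b3_8 b4_7 b4_8 b5_6 b5_7 b5_8 b9_12 b9_13 b9_14 b10_12 b10_13
    b10_14 b11_12 b11_13 b11_14 : ℝ)
    (h : ∀ a b c x y z : ℝ, (a * x + b * y + c * z = 0 ∨ a = x ∧ b = y ∧ c = z) →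
      b0_6 * (a ^ 4 * (x ^ 3 * y) + a ^ 3 * b * (x ^ 4)) +
      b1_6 * (b ^ 4 * (x ^ 3 * y) + a ^ 3 * b * (y ^ 4)) +
      b1_7 * (b ^ 4 * (x * y ^ 3) + a * b ^ 3 * (y ^ 4)) +
      b2_6 * (c ^ 4 * (x ^ 3 * y) + a ^ 3 * b * (z ^ 4)) +
      b2_7 * (c ^ 4 * (x * y ^ 3) + a * b ^ 3 * (z ^ 4)) +
      b3_6 * (b ^ 2 * c ^ 2 * (x ^ 3 * y) + a ^ 3 * b * (y ^ 2 * z ^ 2)) +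
      b3_8 * (b ^ 2 * c ^ 2 * (x * y * z ^ 2) + a * b * c ^ 2 * (y ^ 2 * z ^ 2)) +
      b4_7 * (a ^ 2 * c ^ 2 * (x * y ^ 3) + a * b ^ 3 * (x ^ 2 * z ^ 2)) +
      b4_8 * (a ^ 2 * c ^ 2 * (x * y * z ^ 2) + a * b * c ^ 2 * (x ^ 2 * z ^ 2)) +
      b5_6 * (a ^ 2 * b ^ 2 * (x ^ 3 * y) + a ^ 3 * b * (x ^ 2 * y ^ 2)) +
      b5_7 * (a ^ 2 * b ^ 2 * (x * y ^ 3) + a * b ^ 3 * (x ^ 2 * y ^ 2)) +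
      b5_8 * (a ^ 2 * b ^ 2 * (x * y * z ^ 2) + a * b * c ^ 2 * (x ^ 2 * y ^ 2)) +
      b9_12 * (a ^ 3 * c * (y ^ 3 * z) + b ^ 3 * c * (x ^ 3 * z)) +
      b9_13 * (a ^ 3 * c * (y * z ^ 3) + b * c ^ 3 * (x ^ 3 * z)) +
      b9_14 * (a ^ 3 * c * (x ^ 2 * y * z) + a ^ 2 * b * c * (x ^ 3 * z)) +
      b10_12 * (a * c ^ 3 * (y ^ 3 * z) + b ^ 3 * c * (x * z ^ 3)) +
      b10_13 * (a * c ^ 3 * (y * z ^ 3) + b * c ^ 3 * (x * z ^ 3)) +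
      b10_14 * (a * c ^ 3 * (x ^ 2 * y * z) + a ^ 2 * b * c * (x * z ^ 3)) +
      b11_12 * (a * b ^ 2 * c * (y ^ 3 * z) + b ^ 3 * c * (x * y ^ 2 * z)) +
      b11_13 * (a * b ^ 2 * c * (y * z ^ 3) + b * c ^ 3 * (x * y ^ 2 * z)) +
      b11_14 * (a * b ^ 2 * c * (x ^ 2 * y * z) + a ^ 2 * b * c * (x * y ^ 2 * z)) = 0) :
    b0_6 = 0 ∧ b1_6 = 0 ∧ b1_7 = 0 ∧ b2_6 = 0 ∧ b2_7 = 0 ∧ b3_6 = 0 ∧ b3_8 = 0 ∧ b4_7 = 0 ∧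
    b4_8 = 0 ∧ b5_6 = 0 ∧ b5_7 = 0 ∧ b5_8 = 0 ∧ b9_12 = 0 ∧ b9_13 = 0 ∧ b9_14 = 0 ∧ b10_12 = 0 ∧
    b10_13 = 0 ∧ b10_14 = 0 ∧ b11_12 = 0 ∧ b11_13 = 0 ∧ b11_14 = 0 := by
  have hb2_6 : b2_6 = 0 := by
    linear_combination
      4/3 * h 0 0 1 1 1 0 (.inl (by norm_num)) + (-1/6) * h 0 0 1 1 2 0 (.inl (by norm_num))
  have hb2_7 : b2_7 = 0 := by
    linear_combination
      (-1/3) * h 0 0 1 1 1 0 (.inl (by norm_num)) + 1/6 * h 0 0 1 1 2 0 (.inl (by norm_num))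
  subst hb2_6 hb2_7
  have hb0_6 : b0_6 = 0 := by
    linear_combination
      (-1/4) * h 1 1 0 1 1 0 (.inr ⟨rfl, rfl, rfl⟩) +
      1/100 * h 1 2 0 1 2 0 (.inr ⟨rfl, rfl, rfl⟩) + 1/175 * h 2 1 0 2 1 0 (.inr ⟨rfl, rfl, rfl⟩) +
      (-1/2100) * h 1 3 0 1 3 0 (.inr ⟨rfl, rfl, rfl⟩)
  have hb1_6 : b1_6 = 0 := by
    linear_combination
      (-5/18) * h 1 1 0 1 1 0 (.inr ⟨rfl, rfl, rfl⟩) +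
      4/225 * h 1 2 0 1 2 0 (.inr ⟨rfl, rfl, rfl⟩) +
      4/1575 * h 2 1 0 2 1 0 (.inr ⟨rfl, rfl, rfl⟩) +
      1/150 * h (-1) 2 0 2 1 0 (.inl (by norm_num)) +
      (-1/1050) * h 1 3 0 1 3 0 (.inr ⟨rfl, rfl, rfl⟩)
  have hb1_7 : b1_7 = 0 := by
    linear_combination
      1/36 * h 1 1 0 1 1 0 (.inr ⟨rfl, rfl, rfl⟩) +
      (-1/225) * h 1 2 0 1 2 0 (.inr ⟨rfl, rfl, rfl⟩) +
      (-1/6300) * h 2 1 0 2 1 0 (.inr ⟨rfl, rfl, rfl⟩) +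
      1/2100 * h 1 3 0 1 3 0 (.inr ⟨rfl, rfl, rfl⟩)
  have hb5_6 : b5_6 = 0 := by
    linear_combination
      157/144 * h 1 1 0 1 1 0 (.inr ⟨rfl, rfl, rfl⟩) +
      (-23/450) * h 1 2 0 1 2 0 (.inr ⟨rfl, rfl, rfl⟩) +
      (-7/900) * h 2 1 0 2 1 0 (.inr ⟨rfl, rfl, rfl⟩) +
      1/400 * h 1 3 0 1 3 0 (.inr ⟨rfl, rfl, rfl⟩)
  have hb5_7 : b5_7 = 0 := by
    linear_combination
      (-13/144) * h 1 1 0 1 1 0 (.inr ⟨rfl, rfl, rfl⟩) +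
      1/36 * h 1 2 0 1 2 0 (.inr ⟨rfl, rfl, rfl⟩) +
      (-1/3150) * h 2 1 0 2 1 0 (.inr ⟨rfl, rfl, rfl⟩) +
      (-1/150) * h (-1) 2 0 2 1 0 (.inl (by norm_num)) +
      (-13/8400) * h 1 3 0 1 3 0 (.inr ⟨rfl, rfl, rfl⟩)
  subst hb0_6 hb1_6 hb1_7 hb5_6 hb5_7
  have hb3_6 : b3_6 = 0 := by
    linear_combination
      4/9 * h (-1) 1 0 1 1 1 (.inl (by norm_num)) +
      (-1/90) * h (-1) 2 0 2 1 1 (.inl (by norm_num)) +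
      2/45 * h (-1) 2 1 2 1 0 (.inl (by norm_num))
  have hb4_7 : b4_7 = 0 := by
    linear_combination
      4/9 * h (-1) 1 0 1 1 1 (.inl (by norm_num)) +
      (-2/45) * h (-1) 2 0 2 1 1 (.inl (by norm_num)) +
      1/90 * h (-1) 2 1 2 1 0 (.inl (by norm_num))
  have hb5_8 : b5_8 = 0 := by
    linear_combination
      17/9 * h (-1) 1 0 1 1 1 (.inl (by norm_num)) +
      (-1/18) * h (-1) 2 0 2 1 1 (.inl (by norm_num)) +
      1/18 * h (-1) 2 1 2 1 0 (.inl (by norm_num))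
  have hb9_12 : b9_12 = 0 := by
    linear_combination
      (-2/3) * h (-1) 0 1 1 1 1 (.inl (by norm_num)) +
      5/9 * h (-1) 1 0 1 1 1 (.inl (by norm_num)) + 5/12 * h 0 (-1) 1 1 1 1 (.inl (by norm_num)) +
      1/18 * h (-1) 0 1 1 2 1 (.inl (by norm_num)) +
      (-5/24) * h 0 (-1) 1 2 1 1 (.inl (by norm_num)) +
      1/72 * h (-1) 0 2 2 1 1 (.inl (by norm_num)) +
      (-1/36) * h (-1) 1 2 2 0 1 (.inl (by norm_num)) +
      (-1/72) * h (-1) 2 0 2 1 1 (.inl (by norm_num)) +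
      1/18 * h (-1) 2 1 2 1 0 (.inl (by norm_num))
  have hb9_13 : b9_13 = 0 := by
    linear_combination
      2/3 * h (-1) 0 1 1 1 1 (.inl (by norm_num)) +
      (-1/9) * h (-1) 1 0 1 1 1 (.inl (by norm_num)) +
      (-1/12) * h 0 (-1) 1 1 1 1 (.inl (by norm_num)) +
      (-1/18) * h (-1) 0 1 1 2 1 (.inl (by norm_num)) +
      1/24 * h 0 (-1) 1 2 1 1 (.inl (by norm_num)) +
      (-1/72) * h (-1) 0 2 2 1 1 (.inl (by norm_num)) +
      1/36 * h (-1) 1 2 2 0 1 (.inl (by norm_num)) +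
      1/360 * h (-1) 2 0 2 1 1 (.inl (by norm_num)) +
      (-1/90) * h (-1) 2 1 2 1 0 (.inl (by norm_num))
  have hb10_12 : b10_12 = 0 := by
    linear_combination
      1 * h (-1) 0 1 1 1 1 (.inl (by norm_num)) + (-1/9) * h (-1) 1 0 1 1 1 (.inl (by norm_num)) +
      (-5/12) * h 0 (-1) 1 1 1 1 (.inl (by norm_num)) +
      (-2/9) * h (-1) 0 1 1 2 1 (.inl (by norm_num)) +
      5/24 * h 0 (-1) 1 2 1 1 (.inl (by norm_num)) +
      (-1/72) * h (-1) 0 2 2 1 1 (.inl (by norm_num)) +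
      1/36 * h (-1) 1 2 2 0 1 (.inl (by norm_num)) +
      (-11/360) * h (-1) 2 0 2 1 1 (.inl (by norm_num)) +
      (-2/45) * h (-1) 2 1 2 1 0 (.inl (by norm_num))
  have hb10_14 : b10_14 = 0 := by
    linear_combination
      1/3 * h (-1) 0 1 1 1 1 (.inl (by norm_num)) + 1/9 * h (-1) 1 0 1 1 1 (.inl (by norm_num)) +
      1/12 * h 0 (-1) 1 1 1 1 (.inl (by norm_num)) +
      (-1/24) * h 0 (-1) 1 2 1 1 (.inl (by norm_num)) +
      (-1/24) * h (-1) 0 2 2 1 1 (.inl (by norm_num)) +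
      (-1/360) * h (-1) 2 0 2 1 1 (.inl (by norm_num)) +
      1/90 * h (-1) 2 1 2 1 0 (.inl (by norm_num))
  subst hb3_6 hb4_7 hb5_8 hb9_12 hb9_13 hb10_12 hb10_14
  have hb11_13 : b11_13 = 0 := by
    linear_combination
      1/3 * h 0 (-1) 1 1 1 1 (.inl (by norm_num)) + (-1/24) * h 0 (-1) 2 1 2 1 (.inl (by norm_num))
  subst hb11_13
  have hb10_13 : b10_13 = 0 := by
    linear_combination
      (-1/6) * h (-1) 0 1 1 1 1 (.inl (by norm_num)) +
      (-1/12) * h 0 (-1) 1 1 1 1 (.inl (by norm_num)) +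
      (-1/18) * h 1 1 1 1 1 1 (.inr ⟨rfl, rfl, rfl⟩) +
      (-1/36) * h (-1) 1 1 2 1 1 (.inl (by norm_num)) +
      1/144 * h 1 1 2 1 1 2 (.inr ⟨rfl, rfl, rfl⟩)
  have hb11_14 : b11_14 = 0 := by
    linear_combination
      (-5/6) * h (-1) 0 1 1 1 1 (.inl (by norm_num)) +
      1/12 * h 0 (-1) 1 1 1 1 (.inl (by norm_num)) + 2/9 * h 1 1 1 1 1 1 (.inr ⟨rfl, rfl, rfl⟩) +
      (-11/36) * h (-1) 1 1 2 1 1 (.inl (by norm_num)) +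
      (-1/144) * h 1 1 2 1 1 2 (.inr ⟨rfl, rfl, rfl⟩)
  subst hb10_13 hb11_14
  have hb3_8 : b3_8 = 0 := by
    linear_combination
      5/6 * h 0 (-1) 1 1 1 1 (.inl (by norm_num)) +
      (-1/36) * h 1 1 1 1 1 1 (.inr ⟨rfl, rfl, rfl⟩) + 1/72 * h 1 2 1 1 2 1 (.inr ⟨rfl, rfl, rfl⟩)
  have hb4_8 : b4_8 = 0 := by
    linear_combination
      1/2 * h (-1) 0 1 1 1 1 (.inl (by norm_num)) +
      (-1/3) * h 0 (-1) 1 1 1 1 (.inl (by norm_num)) +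
      5/18 * h 1 1 1 1 1 1 (.inr ⟨rfl, rfl, rfl⟩) + (-1/72) * h 1 2 1 1 2 1 (.inr ⟨rfl, rfl, rfl⟩)
  have hb9_14 : b9_14 = 0 := by
    linear_combination
      (-1/2) * h (-1) 0 1 1 1 1 (.inl (by norm_num)) +
      (-1/3) * h 0 (-1) 1 1 1 1 (.inl (by norm_num)) +
      5/18 * h 1 1 1 1 1 1 (.inr ⟨rfl, rfl, rfl⟩) + (-1/72) * h 1 2 1 1 2 1 (.inr ⟨rfl, rfl, rfl⟩)
  have hb11_12 : b11_12 = 0 := by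
    linear_combination
      (-1/6) * h 0 (-1) 1 1 1 1 (.inl (by norm_num)) +
      (-1/36) * h 1 1 1 1 1 1 (.inr ⟨rfl, rfl, rfl⟩) + 1/72 * h 1 2 1 1 2 1 (.inr ⟨rfl, rfl, rfl⟩)
  subst hb3_8 hb4_8 hb9_14 hb11_12
  simp only [and_self]

set_option maxHeartbeats 2000000 in
/-- The equations for the coefficients of an odeco form of even parity, solved by evaluation. -/
theorem evenBlock_eq_zero
    (b0_0 b0_1 b0_2 b0_3 b1_1 b1_2 b1_4 b2_2 b2_5 b3_3 b4_4 b5_5 b6_6 b6_7 b6_8 b7_7 b7_8 b8_8 b9_9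
    b9_10 b9_11 b10_10 b10_11 b11_11 b12_12 b12_13 b12_14 b13_13 b13_14 b14_14 : ℝ)
    (h : ∀ a b c x y z : ℝ, (a * x + b * y + c * z = 0 ∨ a = x ∧ b = y ∧ c = z) →
      b0_0 * (a ^ 4 * (x ^ 4)) + b0_1 * (a ^ 4 * (y ^ 4) + b ^ 4 * (x ^ 4)) +
      b0_2 * (a ^ 4 * (z ^ 4) + c ^ 4 * (x ^ 4)) +
      b0_3 * (a ^ 4 * (y ^ 2 * z ^ 2) + b ^ 2 * c ^ 2 * (x ^ 4)) + b1_1 * (b ^ 4 * (y ^ 4)) +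
      b1_2 * (b ^ 4 * (z ^ 4) + c ^ 4 * (y ^ 4)) +
      b1_4 * (b ^ 4 * (x ^ 2 * z ^ 2) + a ^ 2 * c ^ 2 * (y ^ 4)) + b2_2 * (c ^ 4 * (z ^ 4)) +
      b2_5 * (c ^ 4 * (x ^ 2 * y ^ 2) + a ^ 2 * b ^ 2 * (z ^ 4)) +
      b3_3 * (b ^ 2 * c ^ 2 * (y ^ 2 * z ^ 2)) + b4_4 * (a ^ 2 * c ^ 2 * (x ^ 2 * z ^ 2)) +
      b5_5 * (a ^ 2 * b ^ 2 * (x ^ 2 * y ^ 2)) + b6_6 * (a ^ 3 * b * (x ^ 3 * y)) +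
      b6_7 * (a ^ 3 * b * (x * y ^ 3) + a * b ^ 3 * (x ^ 3 * y)) +
      b6_8 * (a ^ 3 * b * (x * y * z ^ 2) + a * b * c ^ 2 * (x ^ 3 * y)) +
      b7_7 * (a * b ^ 3 * (x * y ^ 3)) +
      b7_8 * (a * b ^ 3 * (x * y * z ^ 2) + a * b * c ^ 2 * (x * y ^ 3)) +
      b8_8 * (a * b * c ^ 2 * (x * y * z ^ 2)) + b9_9 * (a ^ 3 * c * (x ^ 3 * z)) +
      b9_10 * (a ^ 3 * c * (x * z ^ 3) + a * c ^ 3 * (x ^ 3 * z)) +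
      b9_11 * (a ^ 3 * c * (x * y ^ 2 * z) + a * b ^ 2 * c * (x ^ 3 * z)) +
      b10_10 * (a * c ^ 3 * (x * z ^ 3)) +
      b10_11 * (a * c ^ 3 * (x * y ^ 2 * z) + a * b ^ 2 * c * (x * z ^ 3)) +
      b11_11 * (a * b ^ 2 * c * (x * y ^ 2 * z)) + b12_12 * (b ^ 3 * c * (y ^ 3 * z)) +
      b12_13 * (b ^ 3 * c * (y * z ^ 3) + b * c ^ 3 * (y ^ 3 * z)) +
      b12_14 * (b ^ 3 * c * (x ^ 2 * y * z) + a ^ 2 * b * c * (y ^ 3 * z)) +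
      b13_13 * (b * c ^ 3 * (y * z ^ 3)) +
      b13_14 * (b * c ^ 3 * (x ^ 2 * y * z) + a ^ 2 * b * c * (y * z ^ 3)) +
      b14_14 * (a ^ 2 * b * c * (x ^ 2 * y * z)) = 0) :
    b0_0 = 0 ∧ b0_1 = 0 ∧ b0_2 = 0 ∧ b0_3 = 0 ∧ b1_1 = 0 ∧ b1_2 = 0 ∧ b1_4 = 0 ∧ b2_2 = 0 ∧
    b2_5 = 0 ∧ b3_3 = 0 ∧ b4_4 = 0 ∧ b5_5 = 0 ∧ b6_6 = 0 ∧ b6_7 = 0 ∧ b6_8 = 0 ∧ b7_7 = 0 ∧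
    b7_8 = 0 ∧ b8_8 = 0 ∧ b9_9 = 0 ∧ b9_10 = 0 ∧ b9_11 = 0 ∧ b10_10 = 0 ∧ b10_11 = 0 ∧ b11_11 = 0 ∧
    b12_12 = 0 ∧ b12_13 = 0 ∧ b12_14 = 0 ∧ b13_13 = 0 ∧ b13_14 = 0 ∧ b14_14 = 0 := by
  have hb2_2 : b2_2 = 0 := by
    linear_combination
      1 * h 0 0 1 0 0 1 (.inr ⟨rfl, rfl, rfl⟩)
  subst hb2_2
  have hb1_2 : b1_2 = 0 := by
    linear_combination
      1 * h 0 0 1 0 1 0 (.inl (by norm_num))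
  subst hb1_2
  have hb0_2 : b0_2 = 0 := by
    linear_combination
      1 * h 0 0 1 1 0 0 (.inl (by norm_num))
  subst hb0_2
  have hb1_1 : b1_1 = 0 := by
    linear_combination
      1 * h 0 1 0 0 1 0 (.inr ⟨rfl, rfl, rfl⟩)
  subst hb1_1
  have hb0_1 : b0_1 = 0 := by
    linear_combination
      1 * h 0 1 0 1 0 0 (.inl (by norm_num))
  subst hb0_1
  have hb0_0 : b0_0 = 0 := by
    linear_combination
      1 * h 1 0 0 1 0 0 (.inr ⟨rfl, rfl, rfl⟩)
  subst hb0_0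
  have hb2_5 : b2_5 = 0 := by
    linear_combination
      1 * h 0 0 1 1 1 0 (.inl (by norm_num))
  subst hb2_5
  have hb1_4 : b1_4 = 0 := by
    linear_combination
      1 * h 0 1 0 1 0 1 (.inl (by norm_num))
  subst hb1_4
  have hb0_3 : b0_3 = 0 := by
    linear_combination
      1 * h 0 1 1 1 0 0 (.inl (by norm_num))
  subst hb0_3
  have hb4_4 : b4_4 = 0 := by
    linear_combination
      1/2 * h 1 0 1 1 0 1 (.inr ⟨rfl, rfl, rfl⟩) + 1/2 * h (-1) 0 1 1 0 1 (.inl (by norm_num))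
  subst hb4_4
  have hb5_5 : b5_5 = 0 := by
    linear_combination
      1/2 * h 1 1 0 1 1 0 (.inr ⟨rfl, rfl, rfl⟩) + 1/2 * h (-1) 1 0 1 1 0 (.inl (by norm_num))
  subst hb5_5
  have hb3_3 : b3_3 = 0 := by
    linear_combination
      1/2 * h 0 1 1 0 1 1 (.inr ⟨rfl, rfl, rfl⟩) + 1/2 * h 0 (-1) 1 0 1 1 (.inl (by norm_num))
  subst hb3_3
  have hb12_12 : b12_12 = 0 := by
    linear_combination
      (-4/9) * h 0 1 1 0 1 1 (.inr ⟨rfl, rfl, rfl⟩) +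
      1/180 * h 0 1 2 0 1 2 (.inr ⟨rfl, rfl, rfl⟩) + 1/45 * h 0 2 1 0 2 1 (.inr ⟨rfl, rfl, rfl⟩)
  have hb12_13 : b12_13 = 0 := by
    linear_combination
      17/18 * h 0 1 1 0 1 1 (.inr ⟨rfl, rfl, rfl⟩) +
      (-1/72) * h 0 1 2 0 1 2 (.inr ⟨rfl, rfl, rfl⟩) +
      (-1/72) * h 0 2 1 0 2 1 (.inr ⟨rfl, rfl, rfl⟩)
  have hb13_13 : b13_13 = 0 := by
    linear_combination
      (-4/9) * h 0 1 1 0 1 1 (.inr ⟨rfl, rfl, rfl⟩) + 1/45 * h 0 1 2 0 1 2 (.inr ⟨rfl, rfl, rfl⟩) +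
      1/180 * h 0 2 1 0 2 1 (.inr ⟨rfl, rfl, rfl⟩)
  subst hb12_12 hb12_13 hb13_13
  have hb9_9 : b9_9 = 0 := by
    linear_combination
      (-4/9) * h 1 0 1 1 0 1 (.inr ⟨rfl, rfl, rfl⟩) +
      1/180 * h 1 0 2 1 0 2 (.inr ⟨rfl, rfl, rfl⟩) + 1/45 * h 2 0 1 2 0 1 (.inr ⟨rfl, rfl, rfl⟩)
  have hb9_10 : b9_10 = 0 := by
    linear_combination
      17/18 * h 1 0 1 1 0 1 (.inr ⟨rfl, rfl, rfl⟩) +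
      (-1/72) * h 1 0 2 1 0 2 (.inr ⟨rfl, rfl, rfl⟩) +
      (-1/72) * h 2 0 1 2 0 1 (.inr ⟨rfl, rfl, rfl⟩)
  have hb10_10 : b10_10 = 0 := by
    linear_combination
      (-4/9) * h 1 0 1 1 0 1 (.inr ⟨rfl, rfl, rfl⟩) + 1/45 * h 1 0 2 1 0 2 (.inr ⟨rfl, rfl, rfl⟩) +
      1/180 * h 2 0 1 2 0 1 (.inr ⟨rfl, rfl, rfl⟩)
  subst hb9_9 hb9_10 hb10_10
  have hb6_6 : b6_6 = 0 := by
    linear_combination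
      (-4/9) * h 1 1 0 1 1 0 (.inr ⟨rfl, rfl, rfl⟩) +
      1/180 * h 1 2 0 1 2 0 (.inr ⟨rfl, rfl, rfl⟩) + 1/45 * h 2 1 0 2 1 0 (.inr ⟨rfl, rfl, rfl⟩)
  have hb6_7 : b6_7 = 0 := by
    linear_combination
      17/18 * h 1 1 0 1 1 0 (.inr ⟨rfl, rfl, rfl⟩) +
      (-1/72) * h 1 2 0 1 2 0 (.inr ⟨rfl, rfl, rfl⟩) +
      (-1/72) * h 2 1 0 2 1 0 (.inr ⟨rfl, rfl, rfl⟩)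
  have hb7_7 : b7_7 = 0 := by
    linear_combination
      (-4/9) * h 1 1 0 1 1 0 (.inr ⟨rfl, rfl, rfl⟩) + 1/45 * h 1 2 0 1 2 0 (.inr ⟨rfl, rfl, rfl⟩) +
      1/180 * h 2 1 0 2 1 0 (.inr ⟨rfl, rfl, rfl⟩)
  subst hb6_6 hb6_7 hb7_7
  have hb9_11 : b9_11 = 0 := by
    linear_combination
      (-4/3) * h (-1) 0 1 1 1 1 (.inl (by norm_num)) + 1/12 * h (-1) 0 2 2 1 1 (.inl (by norm_num))
  have hb10_11 : b10_11 = 0 := by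
    linear_combination
      1/3 * h (-1) 0 1 1 1 1 (.inl (by norm_num)) + (-1/12) * h (-1) 0 2 2 1 1 (.inl (by norm_num))
  subst hb9_11 hb10_11
  have hb6_8 : b6_8 = 0 := by
    linear_combination
      (-4/3) * h (-1) 1 0 1 1 1 (.inl (by norm_num)) + 1/12 * h (-1) 2 0 2 1 1 (.inl (by norm_num))
  have hb7_8 : b7_8 = 0 := by
    linear_combination
      1/3 * h (-1) 1 0 1 1 1 (.inl (by norm_num)) + (-1/12) * h (-1) 2 0 2 1 1 (.inl (by norm_num))
  subst hb6_8 hb7_8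
  have hb12_14 : b12_14 = 0 := by
    linear_combination
      (-4/3) * h 0 (-1) 1 1 1 1 (.inl (by norm_num)) + 1/12 * h 0 (-1) 2 1 2 1 (.inl (by norm_num))
  have hb13_14 : b13_14 = 0 := by
    linear_combination
      1/3 * h 0 (-1) 1 1 1 1 (.inl (by norm_num)) + (-1/12) * h 0 (-1) 2 1 2 1 (.inl (by norm_num))
  subst hb12_14 hb13_14
  have hb14_14 : b14_14 = 0 := by
    linear_combination
      1/3 * h 1 1 1 1 1 1 (.inr ⟨rfl, rfl, rfl⟩) + 1/6 * h (-1) 1 1 2 1 1 (.inl (by norm_num))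
  subst hb14_14
  have hb8_8 : b8_8 = 0 := by
    linear_combination
      2/3 * h 1 1 1 1 1 1 (.inr ⟨rfl, rfl, rfl⟩) + (-1/6) * h 1 (-1) 1 1 2 1 (.inl (by norm_num))
  have hb11_11 : b11_11 = 0 := by
    linear_combination
      1/3 * h 1 1 1 1 1 1 (.inr ⟨rfl, rfl, rfl⟩) + 1/6 * h 1 (-1) 1 1 2 1 (.inl (by norm_num))
  subst hb8_8 hb11_11
  simp only [and_self]

/-- The pairs of quartic monomials whose product has even parity. -/
def evenPairs : List (Fin 15 × Fin 15) :=
  [(0, 0), (0, 1), (0, 2), (0, 3), (0, 4), (0, 5), (1, 1), (1, 2), (1, 3), (1, 4), (1, 5), (2, 2),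
    (2, 3), (2, 4), (2, 5), (3, 3), (3, 4), (3, 5), (4, 4), (4, 5), (5, 5), (6, 6), (6, 7), (6, 8),
    (7, 7), (7, 8), (8, 8), (9, 9), (9, 10), (9, 11), (10, 10), (10, 11), (11, 11), (12, 12),
    (12, 13), (12, 14), (13, 13), (13, 14), (14, 14)]

/-- The pairs of quartic monomials whose product has the parity of `xy`. -/
def xyPairs : List (Fin 15 × Fin 15) :=
  [(0, 6), (0, 7), (0, 8), (1, 6), (1, 7), (1, 8), (2, 6), (2, 7), (2, 8), (3, 6), (3, 7), (3, 8),
    (4, 6), (4, 7), (4, 8), (5, 6), (5, 7), (5, 8), (9, 12), (9, 13), (9, 14), (10, 12), (10, 13),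
    (10, 14), (11, 12), (11, 13), (11, 14)]

theorem IsOdecoForm.even_eq_zero {B : Matrix (Fin 15) (Fin 15) ℝ} (hB : IsOdecoForm B)
    (h0_4 : B 0 4 = 0) (h0_5 : B 0 5 = 0) (h1_3 : B 1 3 = 0) (h1_5 : B 1 5 = 0) (h2_3 : B 2 3 = 0)
    (h2_4 : B 2 4 = 0) (h3_4 : B 3 4 = 0) (h3_5 : B 3 5 = 0) (h4_5 : B 4 5 = 0) :
    ∀ p ∈ evenPairs, B p.1 p.2 = 0 := by
  have hs : ∀ m n : Fin 15, B n m = B m n := fun m n => hB.isSymm.apply m n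
  have key := evenBlock_eq_zero
    (B 0 0) (B 0 1) (B 0 2) (B 0 3) (B 1 1) (B 1 2) (B 1 4) (B 2 2) (B 2 5) (B 3 3) (B 4 4) (B 5 5)
    (B 6 6) (B 6 7) (B 6 8) (B 7 7) (B 7 8) (B 8 8) (B 9 9) (B 9 10) (B 9 11) (B 10 10) (B 10 11)
    (B 11 11) (B 12 12) (B 12 13) (B 12 14) (B 13 13) (B 13 14) (B 14 14)
    fun a b c x y z hh => by
      have h := hB.sum_reflect 1 (v := ![a, b, c]) (w := ![x, y, z]) (by
        simpa [Fin.sum_univ_three] using hh)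
      simp [Fin.sum_univ_succ, reflectSign, quarticMonomials] at h
      norm_num at h
      simp only [hs 0 1, hs 0 2, hs 0 3, hs 0 4, hs 0 5, hs 1 2, hs 1 3, hs 1 4, hs 1 5, hs 2 3, hs 2 4,
        hs 2 5, hs 3 4, hs 3 5, hs 4 5, hs 6 7, hs 6 8, hs 7 8, hs 9 10, hs 9 11, hs 10 11,
        hs 12 13, hs 12 14, hs 13 14, h0_4, h0_5, h1_3, h1_5, h2_3, h2_4, h3_4, h3_5, h4_5,
        zero_mul, mul_zero, zero_add, add_zero] at h
      linear_combination h / 4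
  simpa only [evenPairs, List.forall_mem_cons, List.not_mem_nil, false_imp_iff, implies_true,
    h0_4, h0_5, h1_3, h1_5, h2_3, h2_4, h3_4, h3_5, h4_5, and_true, true_and] using key

theorem IsOdecoForm.xy_eq_zero {B : Matrix (Fin 15) (Fin 15) ℝ} (hB : IsOdecoForm B)
    (h0_7 : B 0 7 = 0) (h0_8 : B 0 8 = 0) (h1_8 : B 1 8 = 0) (h2_8 : B 2 8 = 0) (h3_7 : B 3 7 = 0)
    (h4_6 : B 4 6 = 0) :
    ∀ p ∈ xyPairs, B p.1 p.2 = 0 := by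
  have hs : ∀ m n : Fin 15, B n m = B m n := fun m n => hB.isSymm.apply m n
  have key := xyBlock_eq_zero
    (B 0 6) (B 1 6) (B 1 7) (B 2 6) (B 2 7) (B 3 6) (B 3 8) (B 4 7) (B 4 8) (B 5 6) (B 5 7) (B 5 8)
    (B 9 12) (B 9 13) (B 9 14) (B 10 12) (B 10 13) (B 10 14) (B 11 12) (B 11 13) (B 11 14)
    fun a b c x y z hh => by
      have h := hB.sum_reflect ![-1, -1, 1] (v := ![a, b, c]) (w := ![x, y, z]) (by
        simpa [Fin.sum_univ_three] using hh)
      simp [Fin.sum_univ_succ, reflectSign, quarticMonomials] at h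
      norm_num at h
      simp only [hs 0 6, hs 0 7, hs 0 8, hs 1 6, hs 1 7, hs 1 8, hs 2 6, hs 2 7, hs 2 8, hs 3 6, hs 3 7,
        hs 3 8, hs 4 6, hs 4 7, hs 4 8, hs 5 6, hs 5 7, hs 5 8, hs 9 12, hs 9 13, hs 9 14,
        hs 10 12, hs 10 13, hs 10 14, hs 11 12, hs 11 13, hs 11 14, h0_7, h0_8, h1_8, h2_8, h3_7,
        h4_6, zero_mul, mul_zero, zero_add, add_zero] at h
      linear_combination h / 4
  simpa only [xyPairs, List.forall_mem_cons, List.not_mem_nil, false_imp_iff, implies_true,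
    h0_7, h0_8, h1_8, h2_8, h3_7, h4_6, and_true, true_and] using key

/-- The permutation of the quartic monomials induced by `x ↦ y ↦ z ↦ x`. -/
def rotateIdx : Equiv.Perm (Fin 15) where
  toFun := ![1, 2, 0, 4, 5, 3, 12, 13, 14, 7, 6, 8, 10, 9, 11]
  invFun := ![2, 0, 1, 5, 3, 4, 10, 9, 11, 13, 12, 14, 6, 7, 8]
  left_inv := by decide
  right_inv := by decide

/-- The cyclic permutation of the coordinates. -/
def rotateCoords (v : Fin 3 → ℝ) : Fin 3 → ℝ := ![v 2, v 0, v 1]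

theorem quarticMonomials_rotateCoords (v : Fin 3 → ℝ) (m : Fin 15) :
    quarticMonomials (rotateCoords v) (rotateIdx m) = quarticMonomials v m := by
  fin_cases m <;> simp [quarticMonomials, rotateCoords, rotateIdx] <;> ring

theorem IsOdecoForm.rotate {B : Matrix (Fin 15) (Fin 15) ℝ} (hB : IsOdecoForm B) :
    IsOdecoForm (B.submatrix rotateIdx rotateIdx) where
  isSymm := hB.isSymm.submatrix _
  pairing v w h := by
    rw [← hB.pairing (rotateCoords v) (rotateCoords w) (h.imp (fun h => by
      rw [← h]
      simp [Fin.sum_univ_three, rotateCoords]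
      ring) fun h => by rw [h])]
    simp only [quarticPairing]
    symm
    rw [← Equiv.sum_comp rotateIdx]
    refine Finset.sum_congr rfl fun m _ => ?_
    rw [← Equiv.sum_comp rotateIdx]
    refine Finset.sum_congr rfl fun n _ => ?_
    simp only [quarticMonomials_rotateCoords, Matrix.submatrix_apply]

/-- Positions of coefficients that determine an odeco form. -/
def odecoPos : Fin 27 → Fin 15 × Fin 15 :=
  ![(0, 4), (0, 5), (1, 3), (1, 5), (2, 3), (2, 4), (3, 4), (3, 5), (4, 5), (0, 7), (0, 8), (1, 8),
    (2, 8), (3, 7), (4, 6), (1, 13), (1, 14), (2, 14), (0, 14), (4, 13), (5, 12), (2, 9), (2, 11),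
    (0, 11), (1, 11), (5, 9), (3, 10)]

/-- Up to a cyclic permutation, the pair belongs to the lists of even and of `xy` pairs. -/
def IsListedPair (p : Fin 15 × Fin 15) : Prop :=
  p ∈ evenPairs ∨ p ∈ xyPairs ∨ (rotateIdx.symm p.1, rotateIdx.symm p.2) ∈ xyPairs ∨
    (rotateIdx.symm (rotateIdx.symm p.1), rotateIdx.symm (rotateIdx.symm p.2)) ∈ xyPairs

instance (p : Fin 15 × Fin 15) : Decidable (IsListedPair p) := by
  unfold IsListedPair
  infer_instance

theorem isListedPair_or (m n : Fin 15) : IsListedPair (m, n) ∨ IsListedPair (n, m) := by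
  have h : ∀ m n, IsListedPair (m, n) ∨ IsListedPair (n, m) := by decide +kernel
  exact h m n

/-- An odeco form is determined by 27 of its coefficients. -/
theorem IsOdecoForm.eq_zero {B : Matrix (Fin 15) (Fin 15) ℝ} (hB : IsOdecoForm B)
    (h : ∀ i, B (odecoPos i).1 (odecoPos i).2 = 0) : B = 0 := by
  have h0 := hB.even_eq_zero (h 0) (h 1) (h 2) (h 3) (h 4) (h 5) (h 6) (h 7) (h 8)
  have h1 := hB.xy_eq_zero (h 9) (h 10) (h 11) (h 12) (h 13) (h 14)
  have h2 := hB.rotate.xy_eq_zero (h 15) (h 16) (h 17) (h 18) (h 19) (h 20)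
  have h3 := hB.rotate.rotate.xy_eq_zero (h 21) (h 22) (h 23) (h 24) (h 25) (h 26)
  have hlist : ∀ p, IsListedPair p → B p.1 p.2 = 0 := by
    rintro p (hm | hm | hm | hm)
    · exact h0 _ hm
    · exact h1 _ hm
    · simpa using h2 _ hm
    · simpa using h3 _ hm
  ext m n
  rcases isListedPair_or m n with hp | hp
  · exact hlist _ hp
  · rw [← hB.isSymm.apply m n]
    exact hlist _ hp

theorem isOdecoForm_of_mem {B : Matrix (Fin 15) (Fin 15) ℝ}
    (hB : B ∈ vanishingForms id odecoTensors) : IsOdecoForm B :=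
  ⟨hB.1, fun _ _ h => quarticPairing_eq_zero hB h⟩

/-! ### Commutator forms -/

section SymUnit

variable {ι : Type} [DecidableEq ι]

/-- The symmetric matrix of the quadratic form `q m * q n`. -/
noncomputable def symUnit (m n : ι) : Matrix ι ι ℝ :=
  (1 / 2 : ℝ) • (Matrix.single m n 1 + Matrix.single n m 1)

theorem quad_single [Fintype ι] (m n : ι) (q : ι → ℝ) : quad (Matrix.single m n 1) q = q m * q n := by
  rw [quad_eq_sum, Finset.sum_eq_single m, Finset.sum_eq_single n]
  · simp
  · intro j _ hj
    simp [hj.symm]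
  · simp
  · intro i _ hi
    simp [hi.symm]
  · simp

theorem quad_symUnit [Fintype ι] (m n : ι) (q : ι → ℝ) : quad (symUnit m n) q = q m * q n := by
  rw [← quadAt_apply, symUnit, map_smul, map_add, quadAt_apply, quadAt_apply, quad_single,
    quad_single, smul_eq_mul]
  ring

theorem symUnit_isSymm (m n : ι) : (symUnit m n).IsSymm := by
  simp [symUnit, Matrix.IsSymm, Matrix.transpose_add, add_comm]

end SymUnit

/-- The entry `(a, b)` of the commutator of the slices `(i, j)` and `(k, l)` of a tensor. -/
def commutatorEntry {R : Type} [CommRing R] (t : Fin 6 → Fin 3) (T : Fin 15 → R) : R :=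
  ∑ s, (T (quarticIdx (t 0) (t 1) (t 4) s) * T (quarticIdx (t 2) (t 3) s (t 5)) -
    T (quarticIdx (t 2) (t 3) (t 4) s) * T (quarticIdx (t 0) (t 1) s (t 5)))

/-- The commutator entry as a quadratic form. -/
noncomputable def commutatorForm (t : Fin 6 → Fin 3) : Matrix (Fin 15) (Fin 15) ℝ :=
  ∑ s, (symUnit (quarticIdx (t 0) (t 1) (t 4) s) (quarticIdx (t 2) (t 3) s (t 5)) -
    symUnit (quarticIdx (t 2) (t 3) (t 4) s) (quarticIdx (t 0) (t 1) s (t 5)))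

theorem quad_commutatorForm (t : Fin 6 → Fin 3) (T : Fin 15 → ℝ) :
    quad (commutatorForm t) T = commutatorEntry t T := by
  rw [← quadAt_apply, commutatorForm, map_sum, commutatorEntry]
  simp only [map_sub, quadAt_apply, quad_symUnit]

theorem commutatorForm_isSymm (t : Fin 6 → Fin 3) : (commutatorForm t).IsSymm := by
  simp [commutatorForm, Matrix.IsSymm, Matrix.transpose_sum, (symUnit_isSymm _ _).eq]

theorem commutatorEntry_intCast (t : Fin 6 → Fin 3) (T : Fin 15 → ℤ) :
    commutatorEntry t (fun m => (T m : ℝ)) = (commutatorEntry t T : ℤ) := by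
  simp [commutatorEntry]

theorem sum_smul_quarticMonomials_quarticIdx (lam : Fin 3 → ℝ) (v : Fin 3 → E3)
    (a b c d : Fin 3) :
    (∑ i, lam i • quarticMonomials (v i).ofLp) (quarticIdx a b c d) =
      ∑ i, lam i * (v i a * v i b * v i c * v i d) := by
  simp [Finset.sum_apply, quarticMonomials_quarticIdx]

theorem Orthonormal.sum_odeco_mul_odeco {v : Fin 3 → E3} (hv : Orthonormal ℝ v)
    (lam mu : Fin 3 → ℝ) (x y : Fin 3 → ℝ) :
    ∑ s, (∑ p, lam p * (x p * v p s)) * (∑ p, mu p * (y p * v p s)) =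
      ∑ p, lam p * mu p * (x p * y p) := by
  have h1 : ∀ s, (∑ p, lam p * (x p * v p s)) * (∑ p, mu p * (y p * v p s)) =
      ∑ p, ∑ r, (lam p * mu r * (x p * y r)) * (v p s * v r s) := fun s => by
    rw [Finset.sum_mul_sum]
    exact Finset.sum_congr rfl fun p _ => Finset.sum_congr rfl fun r _ => by ring
  simp only [h1]
  rw [Finset.sum_comm]
  refine Finset.sum_congr rfl fun p _ => ?_
  rw [Finset.sum_comm]
  simp only [← Finset.mul_sum, orthonormal_iff_sum.1 hv]
  simp

theorem commutatorForm_mem (t : Fin 6 → Fin 3) :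
    commutatorForm t ∈ vanishingForms id odecoTensors := by
  refine ⟨commutatorForm_isSymm t, ?_⟩
  rintro T ⟨lam, v, hv, rfl⟩
  rw [id, quad_commutatorForm, commutatorEntry, Finset.sum_sub_distrib, sub_eq_zero]
  have h : ∀ i j k l a b : Fin 3,
      ∑ s, (∑ i, lam i • quarticMonomials (v i).ofLp) (quarticIdx i j a s) *
        (∑ i, lam i • quarticMonomials (v i).ofLp) (quarticIdx k l s b) =
      ∑ p, lam p * lam p * ((v p i * v p j * v p a) * (v p k * v p l * v p b)) := by
    intro i j k l a b
    rw [← hv.sum_odeco_mul_odeco lam lam]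
    refine Finset.sum_congr rfl fun s _ => ?_
    rw [quarticIdx_swap_right k l s b, sum_smul_quarticMonomials_quarticIdx,
      sum_smul_quarticMonomials_quarticIdx]
  rw [h, h]
  exact Finset.sum_congr rfl fun p _ => by ring

/-- Commutators that form a basis of the odeco forms. -/
def basicCommutators : Fin 27 → Fin 6 → Fin 3 :=
  ![![0, 2, 1, 1, 1, 2], ![0, 0, 0, 2, 1, 2], ![0, 1, 1, 2, 1, 2], ![0, 2, 2, 2, 1, 2],
    ![0, 0, 1, 2, 0, 2], ![0, 0, 1, 1, 0, 1], ![0, 0, 0, 1, 1, 2], ![0, 0, 1, 1, 0, 2],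
    ![0, 1, 2, 2, 1, 2], ![1, 1, 2, 2, 0, 2], ![0, 1, 1, 1, 1, 2], ![0, 0, 0, 1, 0, 2],
    ![0, 1, 2, 2, 0, 2], ![0, 0, 2, 2, 1, 2], ![0, 1, 1, 1, 0, 2], ![0, 0, 1, 1, 1, 2],
    ![0, 0, 1, 2, 1, 2], ![0, 2, 1, 1, 0, 2], ![0, 1, 0, 2, 1, 2], ![1, 1, 2, 2, 1, 2],
    ![0, 1, 1, 1, 0, 1], ![1, 1, 1, 2, 1, 2], ![1, 2, 2, 2, 1, 2], ![0, 0, 0, 1, 0, 1],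
    ![0, 0, 2, 2, 0, 2], ![0, 0, 0, 2, 0, 2], ![0, 2, 2, 2, 0, 2]]

/-- The two unit vectors that make up the tensors `basicTensors`. -/
def basicTensorsSupport : Fin 27 → Fin 15 × Fin 15 :=
  ![(1, 8), (4, 6), (3, 7), (2, 8), (0, 8), (0, 7), (4, 11), (0, 11), (2, 11), (3, 10), (1, 11),
    (0, 14), (2, 14), (3, 14), (5, 12), (1, 14), (3, 4), (4, 5), (8, 8), (1, 13), (0, 5), (0, 3),
    (0, 13), (0, 6), (0, 10), (0, 9), (0, 4)]

/-- Tensors at which the values of the basic commutators are triangular. -/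
def basicTensors (i : Fin 27) : Fin 15 → ℤ :=
  Pi.single (basicTensorsSupport i).1 1 + Pi.single (basicTensorsSupport i).2 1

theorem basicCommutators_triangular :
    (∀ i j, i < j → commutatorEntry (basicCommutators i) (basicTensors j) = 0) ∧
      ∀ i, commutatorEntry (basicCommutators i) (basicTensors i) ≠ 0 := by
  decide +kernel

/-! ### Octahedral tensors -/

/-- The tensors of the sums of fourth powers of orthonormal coordinates. -/
def octTensors : Set (Fin 15 → ℝ) :=
  {T | ∃ v : Fin 3 → E3, Orthonormal ℝ v ∧ T = ∑ i, quarticMonomials (v i).ofLp}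

/-- The tensors whose contraction is `U 0` times the identity; the remaining coordinates are the
entries `y²z²`, `x²z²`, `x²y²`, `x³y`, `xy³`, `x³z`, `xz³`, `y³z`, `yz³`. -/
def sliceTensor {R : Type} [CommRing R] (U : Fin 10 → R) : Fin 15 → R :=
  ![U 0 - U 2 - U 3, U 0 - U 1 - U 3, U 0 - U 1 - U 2, U 1, U 2, U 3, U 4, U 5, -U 4 - U 5,
    U 6, U 7, -U 6 - U 7, U 8, U 9, -U 8 - U 9]

/-- The octahedral tensors in slice coordinates. -/
def octSlice : Set (Fin 10 → ℝ) := {U | sliceTensor U ∈ octTensors}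

theorem mem_octSlice_of_orthogonal {v : Fin 3 → Fin 3 → ℝ} (h0 : ∀ i, v i ≠ 0)
    (h : ∀ i j, i ≠ j → ∑ k, v i k * v j k = 0) {U : Fin 10 → ℝ}
    (hU : ∀ m, sliceTensor U m = ∑ i, ((∑ k, v i k ^ 2) ^ 2)⁻¹ * quarticMonomials (v i) m) :
    U ∈ octSlice := by
  obtain ⟨u, hu, huv⟩ := exists_orthonormal_of_orthogonal h0 h
  refine ⟨u, hu, ?_⟩
  ext m
  rw [hU, Finset.sum_apply]
  refine Finset.sum_congr rfl fun i _ => ?_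
  have hpos : (∑ k, v i k ^ 2) ^ 2 ≠ 0 := by
    obtain ⟨k, hk⟩ := Function.ne_iff.1 (h0 i)
    have hk' : 0 < v i k ^ 2 := by
      have : v i k ≠ 0 := hk
      positivity
    have := Finset.single_le_sum (f := fun k => v i k ^ 2) (fun k _ => sq_nonneg _)
      (Finset.mem_univ k)
    have : 0 < ∑ k, v i k ^ 2 := by linarith
    positivity
  rw [huv, Pi.smul_apply, smul_eq_mul, inv_mul_cancel_left₀ hpos]

theorem Orthonormal.toLp_comp {v : Fin 3 → E3} (hv : Orthonormal ℝ v)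
    {f : (Fin 3 → ℝ) → Fin 3 → ℝ} (hf : ∀ x y, ∑ k, f x k * f y k = ∑ k, x k * y k) :
    Orthonormal ℝ fun i => (WithLp.toLp 2 (f (v i).ofLp) : E3) := by
  rw [orthonormal_iff_sum] at hv ⊢
  intro i j
  rw [← hv i j]
  exact hf _ _

/-- The signs of the slice coordinates under reflection of a coordinate. -/
def sliceSign : Fin 3 → Fin 10 → ℤ :=
  ![![1, 1, 1, 1, -1, -1, -1, -1, 1, 1], ![1, 1, 1, 1, -1, -1, 1, 1, -1, -1],
    ![1, 1, 1, 1, 1, 1, -1, -1, -1, -1]]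

theorem octSlice_reflect {U : Fin 10 → ℝ} (hU : U ∈ octSlice) (i : Fin 3) :
    (fun m => (sliceSign i m : ℝ) * U m) ∈ octSlice := by
  obtain ⟨v, hv, hUv⟩ := hU
  refine ⟨_, hv.toLp_comp (f := reflectCoord i) fun x y => Finset.sum_congr rfl fun k _ => by
    by_cases hk : k = i <;> simp [reflectCoord, hk], ?_⟩
  ext m
  have h1 : sliceTensor (fun m => (sliceSign i m : ℝ) * U m) m =
      reflectSign i m * sliceTensor U m := by
    fin_cases i <;> fin_cases m <;> simp [sliceTensor, sliceSign, reflectSign] <;> ring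
  rw [h1, hUv, Finset.sum_apply, Finset.sum_apply, Finset.mul_sum]
  exact Finset.sum_congr rfl fun k _ => (quarticMonomials_reflectCoord i _ m).symm

/-- The permutation of the slice coordinates induced by `x ↦ y ↦ z ↦ x`. -/
def rotateSlice : Equiv.Perm (Fin 10) where
  toFun := ![0, 2, 3, 1, 8, 9, 5, 4, 7, 6]
  invFun := ![0, 3, 1, 2, 7, 6, 9, 8, 4, 5]
  left_inv := by decide
  right_inv := by decide

theorem octSlice_rotate {U : Fin 10 → ℝ} (hU : U ∈ octSlice) : U ∘ rotateSlice.symm ∈ octSlice := by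
  obtain ⟨v, hv, hUv⟩ := hU
  refine ⟨_, hv.toLp_comp (f := rotateCoords) fun x y => ?_, ?_⟩
  · simp [Fin.sum_univ_three, rotateCoords]
    ring
  ext m
  obtain ⟨m, rfl⟩ := rotateIdx.surjective m
  have h1 : sliceTensor (U ∘ rotateSlice.symm) (rotateIdx m) = sliceTensor U m := by
    fin_cases m <;> simp [sliceTensor, rotateSlice, rotateIdx] <;> ring
  rw [h1, hUv, Finset.sum_apply, Finset.sum_apply]
  exact Finset.sum_congr rfl fun k _ => (quarticMonomials_rotateCoords _ m).symm

theorem sum_reflect_of_mem {B : Matrix (Fin 10) (Fin 10) ℝ}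
    (hB : B ∈ vanishingForms id octSlice) (c : Fin 3 → ℤ) {U : Fin 10 → ℝ} (hU : U ∈ octSlice) :
    ∑ m, ∑ n, ((1 + ∑ i, c i * (sliceSign i m * sliceSign i n) : ℤ) : ℝ) *
      (B m n * (U m * U n)) = 0 := by
  have h0 := hB.2 U hU
  have h1 : ∀ i, ∑ m, ∑ n, ((sliceSign i m * sliceSign i n : ℤ) : ℝ) *
      (B m n * (U m * U n)) = 0 := fun i => by
    rw [← hB.2 _ (octSlice_reflect hU i), quad_eq_sum]
    push_cast
    exact Finset.sum_congr rfl fun m _ => Finset.sum_congr rfl fun n _ => by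
      simp only [id]
      ring
  rw [id, quad_eq_sum] at h0
  have h2 : ∑ i, (c i : ℝ) * ∑ m, ∑ n, ((sliceSign i m * sliceSign i n : ℤ) : ℝ) *
      (B m n * (U m * U n)) = 0 := Finset.sum_eq_zero fun i _ => by rw [h1, mul_zero]
  have h3 : ∑ m, ∑ n, ((1 + ∑ i, c i * (sliceSign i m * sliceSign i n) : ℤ) : ℝ) *
      (B m n * (U m * U n)) = ∑ m, ∑ n, B m n * (U m * U n) +
      ∑ i, (c i : ℝ) * ∑ m, ∑ n, ((sliceSign i m * sliceSign i n : ℤ) : ℝ) *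
        (B m n * (U m * U n)) := by
    simp only [Fin.sum_univ_three, Finset.mul_sum, ← Finset.sum_add_distrib]
    refine Finset.sum_congr rfl fun m _ => Finset.sum_congr rfl fun n _ => ?_
    push_cast
    ring
  rw [h3, h0, h2, add_zero]

theorem rotate_mem {B : Matrix (Fin 10) (Fin 10) ℝ} (hB : B ∈ vanishingForms id octSlice) :
    B.submatrix rotateSlice rotateSlice ∈ vanishingForms id octSlice := by
  refine ⟨hB.1.submatrix _, fun U hU => ?_⟩
  rw [← hB.2 _ (octSlice_rotate hU), quad_eq_sum, quad_eq_sum]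
  symm
  rw [← Equiv.sum_comp rotateSlice]
  refine Finset.sum_congr rfl fun m _ => ?_
  rw [← Equiv.sum_comp rotateSlice]
  refine Finset.sum_congr rfl fun n _ => ?_
  simp

/-! ### The coefficients of octahedral forms -/

set_option linter.unreachableTactic false
set_option linter.unusedTactic false
set_option linter.unnecessarySeqFocus false

/-- The equations for the coefficients of an octahedral form of parity `xy`, solved by evaluation. -/
theorem octXYBlock_eq_zero
    (b0_5 b1_5 b2_5 b3_4 b3_5 b6_8 b6_9 b7_8 b7_9 : ℝ)
    (h : ∀ l x y z a b c d e f : ℝ, ![l, x, y, z, a, b, c, d, e, f] ∈ octSlice →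
      b0_5 * (l * b) + b1_5 * (x * b) + b2_5 * (y * b) + b3_4 * (z * a) + b3_5 * (z * b) +
      b6_8 * (c * e) + b6_9 * (c * f) + b7_8 * (d * e) + b7_9 * (d * f) = 0) :
    b0_5 = 0 ∧ b1_5 = 0 ∧ b2_5 = 0 ∧ b3_4 = 0 ∧ b3_5 = 0 ∧ b6_8 = 0 ∧ b6_9 = 0 ∧ b7_8 = 0 ∧
    b7_9 = 0 := by
  have p0 := h 1 0 0 (8/25) (6/25) (-6/25) 0 0 0 0
    (mem_octSlice_of_orthogonal (v := ![![0, 0, 1], ![1, -2, 0], ![2, 1, 0]])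
      (by simp [Fin.forall_fin_succ])
      (by simp [Fin.forall_fin_succ, Fin.sum_univ_three] <;> norm_num)
      (by simp [Fin.forall_fin_succ, Fin.sum_univ_three, sliceTensor, quarticMonomials] <;>
        norm_num))
  have p1 := h 1 0 0 (9/50) (6/25) (-6/25) 0 0 0 0
    (mem_octSlice_of_orthogonal (v := ![![0, 0, 1], ![1, -3, 0], ![3, 1, 0]])
      (by simp [Fin.forall_fin_succ])
      (by simp [Fin.forall_fin_succ, Fin.sum_univ_three] <;> norm_num)
      (by simp [Fin.forall_fin_succ, Fin.sum_univ_three, sliceTensor, quarticMonomials] <;>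
        norm_num))
  have p2 := h 1 (7/18) (2/9) (2/9) (1/9) (-1/18) (1/9) (-1/18) (-1/9) (-1/9)
    (mem_octSlice_of_orthogonal (v := ![![0, 1, -1], ![1, -1, -1], ![2, 1, 1]])
      (by simp [Fin.forall_fin_succ])
      (by simp [Fin.forall_fin_succ, Fin.sum_univ_three] <;> norm_num)
      (by simp [Fin.forall_fin_succ, Fin.sum_univ_three, sliceTensor, quarticMonomials] <;>
        norm_num))
  have p3 := h 1 (73/162) (8/81) (8/81) (14/81) (-7/81) (14/81) (-7/81) (-4/81) (-4/81)
    (mem_octSlice_of_orthogonal (v := ![![0, 1, -1], ![1, -2, -2], ![4, 1, 1]])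
      (by simp [Fin.forall_fin_succ])
      (by simp [Fin.forall_fin_succ, Fin.sum_univ_three] <;> norm_num)
      (by simp [Fin.forall_fin_succ, Fin.sum_univ_three, sliceTensor, quarticMonomials] <;>
        norm_num))
  have p4 := h 1 (2/9) (7/18) (2/9) (1/18) (-1/9) (1/9) (1/9) (1/9) (-1/18)
    (mem_octSlice_of_orthogonal (v := ![![1, -2, -1], ![1, 0, 1], ![1, 1, -1]])
      (by simp [Fin.forall_fin_succ])
      (by simp [Fin.forall_fin_succ, Fin.sum_univ_three] <;> norm_num)
      (by simp [Fin.forall_fin_succ, Fin.sum_univ_three, sliceTensor, quarticMonomials] <;>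
        norm_num))
  have p5 := h 1 (8/81) (73/162) (8/81) (7/81) (-14/81) (4/81) (4/81) (14/81) (-7/81)
    (mem_octSlice_of_orthogonal (v := ![![1, -4, -1], ![1, 0, 1], ![2, 1, -2]])
      (by simp [Fin.forall_fin_succ])
      (by simp [Fin.forall_fin_succ, Fin.sum_univ_three] <;> norm_num)
      (by simp [Fin.forall_fin_succ, Fin.sum_univ_three, sliceTensor, quarticMonomials] <;>
        norm_num))
  have p6 := h 1 (2/9) (2/9) (7/18) (1/9) (1/9) (1/18) (-1/9) (-1/18) (1/9)
    (mem_octSlice_of_orthogonal (v := ![![1, -1, -2], ![1, -1, 1], ![1, 1, 0]])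
      (by simp [Fin.forall_fin_succ])
      (by simp [Fin.forall_fin_succ, Fin.sum_univ_three] <;> norm_num)
      (by simp [Fin.forall_fin_succ, Fin.sum_univ_three, sliceTensor, quarticMonomials] <;>
        norm_num))
  have p7 := h 1 (8/81) (8/81) (73/162) (4/81) (4/81) (7/81) (-14/81) (-7/81) (14/81)
    (mem_octSlice_of_orthogonal (v := ![![1, -1, -4], ![1, 1, 0], ![2, -2, 1]])
      (by simp [Fin.forall_fin_succ])
      (by simp [Fin.forall_fin_succ, Fin.sum_univ_three] <;> norm_num)
      (by simp [Fin.forall_fin_succ, Fin.sum_univ_three, sliceTensor, quarticMonomials] <;>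
        norm_num))
  have p8 := h 1 (8/27) (8/27) (8/27) (2/27) (2/27) (2/27) (2/27) (2/27) (2/27)
    (mem_octSlice_of_orthogonal (v := ![![1, -2, -2], ![2, -1, 2], ![2, 2, -1]])
      (by simp [Fin.forall_fin_succ])
      (by simp [Fin.forall_fin_succ, Fin.sum_univ_three] <;> norm_num)
      (by simp [Fin.forall_fin_succ, Fin.sum_univ_three, sliceTensor, quarticMonomials] <;>
        norm_num))
  have hb0_5 : b0_5 = 0 := by
    linear_combination
      75/14 * p0 + (-200/21) * p1
  subst hb0_5
  have hb1_5 : b1_5 = 0 := by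
    linear_combination
      144/5 * p2 + (-1458/35) * p3
  subst hb1_5
  have hb2_5 : b2_5 = 0 := by
    linear_combination
      72/5 * p4 + (-729/35) * p5
  subst hb2_5
  have hb3_4 : b3_4 = 0 := by
    linear_combination
      625/96 * p0 + 147/10 * p6 + (-243/40) * p7
  have hb3_5 : b3_5 = 0 := by
    linear_combination
      (-625/96) * p0 + 147/10 * p6 + (-243/40) * p7
  have hb6_8 : b6_8 = 0 := by
    linear_combination
      (-36) * p2 + 36 * p4 + 114/5 * p6 + (-243/10) * p7
  subst hb3_4 hb3_5 hb6_8
  have hb6_9 : b6_9 = 0 := by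
    linear_combination
      (-54) * p2 + 243/4 * p8
  have hb7_8 : b7_8 = 0 := by
    linear_combination
      54 * p4 + 243/4 * p8
  have hb7_9 : b7_9 = 0 := by
    linear_combination
      54 * p2 + (-54) * p4 + 243/4 * p8
  subst hb6_9 hb7_8 hb7_9
  simp only [and_self]

/-- The equations for the coefficients of an octahedral form of even parity, solved by
evaluation. -/
theorem octEvenBlock_eq_zero
    (b0_0 b1_1 b2_2 b3_3 b4_4 b4_5 b5_5 b6_6 b6_7 b7_7 b8_8 b8_9 b9_9 : ℝ)
    (h : ∀ l x y z a b c d e f : ℝ, ![l, x, y, z, a, b, c, d, e, f] ∈ octSlice →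
      b0_0 * (l * l) + b1_1 * (x * x) + b2_2 * (y * y) + b3_3 * (z * z) + b4_4 * (a * a) +
      b4_5 * (a * b) + b5_5 * (b * b) + b6_6 * (c * c) + b6_7 * (c * d) + b7_7 * (d * d) +
      b8_8 * (e * e) + b8_9 * (e * f) + b9_9 * (f * f) = 0) :
    b0_0 = 0 ∧ b1_1 = 0 ∧ b2_2 = 0 ∧ b3_3 = 0 ∧ b4_4 = 0 ∧ b4_5 = 0 ∧ b5_5 = 0 ∧ b6_6 = 0 ∧
    b6_7 = 0 ∧ b7_7 = 0 ∧ b8_8 = 0 ∧ b8_9 = 0 ∧ b9_9 = 0 := by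
  have p0 := h 1 0 0 0 0 0 0 0 0 0
    (mem_octSlice_of_orthogonal (v := ![![0, 0, 1], ![0, 1, 0], ![1, 0, 0]])
      (by simp [Fin.forall_fin_succ])
      (by simp [Fin.forall_fin_succ, Fin.sum_univ_three] <;> norm_num)
      (by simp [Fin.forall_fin_succ, Fin.sum_univ_three, sliceTensor, quarticMonomials] <;>
        norm_num))
  have p1 := h 1 0 0 (1/2) 0 0 0 0 0 0
    (mem_octSlice_of_orthogonal (v := ![![0, 0, 1], ![1, -1, 0], ![1, 1, 0]])
      (by simp [Fin.forall_fin_succ])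
      (by simp [Fin.forall_fin_succ, Fin.sum_univ_three] <;> norm_num)
      (by simp [Fin.forall_fin_succ, Fin.sum_univ_three, sliceTensor, quarticMonomials] <;>
        norm_num))
  have p2 := h 1 (1/2) 0 0 0 0 0 0 0 0
    (mem_octSlice_of_orthogonal (v := ![![0, 1, -1], ![0, 1, 1], ![1, 0, 0]])
      (by simp [Fin.forall_fin_succ])
      (by simp [Fin.forall_fin_succ, Fin.sum_univ_three] <;> norm_num)
      (by simp [Fin.forall_fin_succ, Fin.sum_univ_three, sliceTensor, quarticMonomials] <;>
        norm_num))
  have p3 := h 1 0 (1/2) 0 0 0 0 0 0 0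
    (mem_octSlice_of_orthogonal (v := ![![0, 1, 0], ![1, 0, -1], ![1, 0, 1]])
      (by simp [Fin.forall_fin_succ])
      (by simp [Fin.forall_fin_succ, Fin.sum_univ_three] <;> norm_num)
      (by simp [Fin.forall_fin_succ, Fin.sum_univ_three, sliceTensor, quarticMonomials] <;>
        norm_num))
  have p4 := h 1 (8/25) 0 0 0 0 0 0 (6/25) (-6/25)
    (mem_octSlice_of_orthogonal (v := ![![0, 1, -2], ![0, 2, 1], ![1, 0, 0]])
      (by simp [Fin.forall_fin_succ])
      (by simp [Fin.forall_fin_succ, Fin.sum_univ_three] <;> norm_num)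
      (by simp [Fin.forall_fin_succ, Fin.sum_univ_three, sliceTensor, quarticMonomials] <;>
        norm_num))
  have p5 := h 1 (7/18) (2/9) (2/9) (1/9) (-1/18) (1/9) (-1/18) (-1/9) (-1/9)
    (mem_octSlice_of_orthogonal (v := ![![0, 1, -1], ![1, -1, -1], ![2, 1, 1]])
      (by simp [Fin.forall_fin_succ])
      (by simp [Fin.forall_fin_succ, Fin.sum_univ_three] <;> norm_num)
      (by simp [Fin.forall_fin_succ, Fin.sum_univ_three, sliceTensor, quarticMonomials] <;>
        norm_num))
  have p6 := h 1 (73/162) (8/81) (8/81) (14/81) (-7/81) (14/81) (-7/81) (-4/81) (-4/81)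
    (mem_octSlice_of_orthogonal (v := ![![0, 1, -1], ![1, -2, -2], ![4, 1, 1]])
      (by simp [Fin.forall_fin_succ])
      (by simp [Fin.forall_fin_succ, Fin.sum_univ_three] <;> norm_num)
      (by simp [Fin.forall_fin_succ, Fin.sum_univ_three, sliceTensor, quarticMonomials] <;>
        norm_num))
  have p7 := h 1 0 0 (8/25) (6/25) (-6/25) 0 0 0 0
    (mem_octSlice_of_orthogonal (v := ![![0, 0, 1], ![1, -2, 0], ![2, 1, 0]])
      (by simp [Fin.forall_fin_succ])
      (by simp [Fin.forall_fin_succ, Fin.sum_univ_three] <;> norm_num)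
      (by simp [Fin.forall_fin_succ, Fin.sum_univ_three, sliceTensor, quarticMonomials] <;>
        norm_num))
  have p8 := h 1 0 (8/25) 0 0 0 (6/25) (-6/25) 0 0
    (mem_octSlice_of_orthogonal (v := ![![0, 1, 0], ![1, 0, -2], ![2, 0, 1]])
      (by simp [Fin.forall_fin_succ])
      (by simp [Fin.forall_fin_succ, Fin.sum_univ_three] <;> norm_num)
      (by simp [Fin.forall_fin_succ, Fin.sum_univ_three, sliceTensor, quarticMonomials] <;>
        norm_num))
  have p9 := h 1 (2/9) (7/18) (2/9) (1/18) (-1/9) (1/9) (1/9) (1/9) (-1/18)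
    (mem_octSlice_of_orthogonal (v := ![![1, -2, -1], ![1, 0, 1], ![1, 1, -1]])
      (by simp [Fin.forall_fin_succ])
      (by simp [Fin.forall_fin_succ, Fin.sum_univ_three] <;> norm_num)
      (by simp [Fin.forall_fin_succ, Fin.sum_univ_three, sliceTensor, quarticMonomials] <;>
        norm_num))
  have p10 := h 1 (2/9) (2/9) (7/18) (1/9) (1/9) (1/18) (-1/9) (-1/18) (1/9)
    (mem_octSlice_of_orthogonal (v := ![![1, -1, -2], ![1, -1, 1], ![1, 1, 0]])
      (by simp [Fin.forall_fin_succ])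
      (by simp [Fin.forall_fin_succ, Fin.sum_univ_three] <;> norm_num)
      (by simp [Fin.forall_fin_succ, Fin.sum_univ_three, sliceTensor, quarticMonomials] <;>
        norm_num))
  have p11 := h 1 (8/81) (73/162) (8/81) (7/81) (-14/81) (4/81) (4/81) (14/81) (-7/81)
    (mem_octSlice_of_orthogonal (v := ![![1, -4, -1], ![1, 0, 1], ![2, 1, -2]])
      (by simp [Fin.forall_fin_succ])
      (by simp [Fin.forall_fin_succ, Fin.sum_univ_three] <;> norm_num)
      (by simp [Fin.forall_fin_succ, Fin.sum_univ_three, sliceTensor, quarticMonomials] <;>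
        norm_num))
  have p12 := h 1 (193/882) (134/441) (74/441) (76/441) (-44/441) (-46/441) (89/441) (109/441) (-41/441)
    (mem_octSlice_of_orthogonal (v := ![![1, -4, -2], ![2, -1, 3], ![2, 1, -1]])
      (by simp [Fin.forall_fin_succ])
      (by simp [Fin.forall_fin_succ, Fin.sum_univ_three] <;> norm_num)
      (by simp [Fin.forall_fin_succ, Fin.sum_univ_three, sliceTensor, quarticMonomials] <;>
        norm_num))
  have hb0_0 : b0_0 = 0 := by
    linear_combination
      1 * p0
  subst hb0_0
  have hb3_3 : b3_3 = 0 := by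
    linear_combination
      4 * p1
  subst hb3_3
  have hb1_1 : b1_1 = 0 := by
    linear_combination
      4 * p2
  subst hb1_1
  have hb2_2 : b2_2 = 0 := by
    linear_combination
      4 * p3
  subst hb2_2
  have hb8_9 : b8_9 = 0 := by
    linear_combination
      (-625/72) * p4 + 441/10 * p5 + (-729/40) * p6
  subst hb8_9
  have hb4_5 : b4_5 = 0 := by
    linear_combination
      (-625/36) * p7 + (-625/36) * p4 + (-625/72) * p8 + 36 * p5 + (-81/10) * p9 + 36 * p10 +
      729/40 * p11
  have hb6_7 : b6_7 = 0 := by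
    linear_combination
      (-625/72) * p8 + 441/10 * p9 + (-729/40) * p11
  subst hb4_5 hb6_7
  have hb4_4 : b4_4 = 0 := by
    linear_combination
      135125/15876 * p7 + (-27875/5292) * p4 + 13000/3969 * p8 + 1548/49 * p5 + (-2720/49) * p9 +
      49/5 * p12
  have hb5_5 : b5_5 = 0 := by
    linear_combination
      35125/3969 * p7 + 27875/5292 * p4 + (-13000/3969) * p8 + (-1548/49) * p5 + 2720/49 * p9 +
      (-49/5) * p12
  have hb6_6 : b6_6 = 0 := by
    linear_combination
      (-56750/3969) * p7 + (-94625/5292) * p4 + (-143875/15876) * p8 + 3744/49 * p5 +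
      2720/49 * p9 + (-49/5) * p12
  have hb7_7 : b7_7 = 0 := by
    linear_combination
      56750/3969 * p7 + 94625/5292 * p4 + 104875/3969 * p8 + (-3744/49) * p5 + (-2720/49) * p9 +
      49/5 * p12
  have hb8_8 : b8_8 = 0 := by
    linear_combination
      (-232375/15876) * p7 + (-1625/147) * p4 + (-78875/3969) * p8 + 1548/49 * p5 + 2572/49 * p9 +
      49/5 * p12
  have hb9_9 : b9_9 = 0 := by
    linear_combination
      232375/15876 * p7 + 50125/1764 * p4 + 78875/3969 * p8 + (-1548/49) * p5 + (-2572/49) * p9 +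
      (-49/5) * p12
  subst hb4_4 hb5_5 hb6_6 hb7_7 hb8_8 hb9_9
  simp only [and_self]

/-- The pairs of slice coordinates whose product has even parity. -/
def evenSlicePairs : List (Fin 10 × Fin 10) :=
  [(0, 0), (0, 1), (0, 2), (0, 3), (1, 1), (1, 2), (1, 3), (2, 2), (2, 3), (3, 3), (4, 4), (4, 5),
    (5, 5), (6, 6), (6, 7), (7, 7), (8, 8), (8, 9), (9, 9)]

/-- The pairs of slice coordinates whose product has the parity of `xy`. -/
def xySlicePairs : List (Fin 10 × Fin 10) :=
  [(0, 4), (0, 5), (1, 4), (1, 5), (2, 4), (2, 5), (3, 4), (3, 5), (6, 8), (6, 9), (7, 8), (7, 9)]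

theorem octForm_even_eq_zero {B : Matrix (Fin 10) (Fin 10) ℝ} (hB : B ∈ vanishingForms id octSlice)
    (h0_1 : B 0 1 = 0) (h0_2 : B 0 2 = 0) (h0_3 : B 0 3 = 0) (h1_2 : B 1 2 = 0) (h1_3 : B 1 3 = 0)
    (h2_3 : B 2 3 = 0) :
    ∀ p ∈ evenSlicePairs, B p.1 p.2 = 0 := by
  have hs : ∀ m n : Fin 10, B n m = B m n := fun m n => hB.1.apply m n
  have key := octEvenBlock_eq_zero
    (B 0 0) (B 1 1) (B 2 2) (B 3 3) (B 4 4) (2 * B 4 5) (B 5 5) (B 6 6) (2 * B 6 7) (B 7 7) (B 8 8)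
    (2 * B 8 9) (B 9 9)
    fun l x y z a b c d e f hU => by
      have h := sum_reflect_of_mem hB 1 hU
      simp [Fin.sum_univ_succ, sliceSign] at h
      norm_num at h
      simp only [hs 0 1, hs 0 2, hs 0 3, hs 1 2, hs 1 3, hs 2 3, hs 4 5, hs 6 7, hs 8 9, h0_1, h0_2, h0_3,
        h1_2, h1_3, h2_3, zero_mul, mul_zero, zero_add, add_zero] at h
      linear_combination h / 4
  simpa [evenSlicePairs, h0_1, h0_2, h0_3, h1_2, h1_3, h2_3] using key

theorem octForm_xy_eq_zero {B : Matrix (Fin 10) (Fin 10) ℝ} (hB : B ∈ vanishingForms id octSlice)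
    (h0_4 : B 0 4 = 0) (h1_4 : B 1 4 = 0) (h2_4 : B 2 4 = 0) :
    ∀ p ∈ xySlicePairs, B p.1 p.2 = 0 := by
  have hs : ∀ m n : Fin 10, B n m = B m n := fun m n => hB.1.apply m n
  have key := octXYBlock_eq_zero
    (2 * B 0 5) (2 * B 1 5) (2 * B 2 5) (2 * B 3 4) (2 * B 3 5) (2 * B 6 8) (2 * B 6 9) (2 * B 7 8)
    (2 * B 7 9)
    fun l x y z a b c d e f hU => by
      have h := sum_reflect_of_mem hB ![-1, -1, 1] hU
      simp [Fin.sum_univ_succ, sliceSign] at h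
      norm_num at h
      simp only [hs 0 4, hs 0 5, hs 1 4, hs 1 5, hs 2 4, hs 2 5, hs 3 4, hs 3 5, hs 6 8, hs 6 9, hs 7 8,
        hs 7 9, h0_4, h1_4, h2_4, zero_mul, mul_zero, zero_add] at h
      linear_combination h / 4
  simpa [xySlicePairs, h0_4, h1_4, h2_4] using key

/-- Positions of coefficients that determine an octahedral form. -/
def octPos : Fin 15 → Fin 10 × Fin 10 :=
  ![(0, 1), (0, 2), (0, 3), (1, 2), (1, 3), (2, 3), (0, 4), (1, 4), (2, 4), (0, 8), (2, 8), (3, 8),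
    (0, 7), (3, 7), (1, 7)]

/-- Up to a cyclic permutation, the pair belongs to the lists of even and of `xy` pairs. -/
def IsListedSlicePair (p : Fin 10 × Fin 10) : Prop :=
  p ∈ evenSlicePairs ∨ p ∈ xySlicePairs ∨
    (rotateSlice.symm p.1, rotateSlice.symm p.2) ∈ xySlicePairs ∨
    (rotateSlice.symm (rotateSlice.symm p.1), rotateSlice.symm (rotateSlice.symm p.2)) ∈
      xySlicePairs

instance (p : Fin 10 × Fin 10) : Decidable (IsListedSlicePair p) := by
  unfold IsListedSlicePair
  infer_instance

theorem isListedSlicePair_or (m n : Fin 10) :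
    IsListedSlicePair (m, n) ∨ IsListedSlicePair (n, m) := by
  have h : ∀ m n, IsListedSlicePair (m, n) ∨ IsListedSlicePair (n, m) := by decide +kernel
  exact h m n

/-- Commutators whose restrictions form a basis of the octahedral forms. -/
def sliceCommutators : Fin 15 → Fin 6 → Fin 3 :=
  ![![0, 1, 1, 2, 1, 2], ![0, 2, 1, 1, 1, 2], ![0, 2, 2, 2, 1, 2], ![0, 2, 1, 2, 1, 2],
    ![0, 0, 0, 1, 1, 2], ![0, 0, 1, 2, 0, 1], ![0, 2, 1, 2, 0, 2], ![1, 1, 2, 2, 1, 2],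
    ![0, 0, 0, 1, 0, 2], ![0, 0, 0, 1, 0, 1], ![0, 1, 2, 2, 0, 1], ![0, 1, 0, 2, 1, 2],
    ![0, 0, 1, 2, 1, 2], ![1, 1, 1, 2, 1, 2], ![0, 2, 2, 2, 0, 2]]

/-- The two unit vectors that make up the vectors `slicePoints`. -/
def slicePointsSupport : Fin 15 → Fin 10 × Fin 10 :=
  ![(1, 4), (0, 4), (2, 4), (1, 6), (3, 6), (0, 6), (1, 8), (0, 8), (3, 8), (0, 3), (5, 5), (4, 5),
    (1, 2), (0, 1), (0, 2)]

/-- Slice coordinates at which the values of the commutators are triangular. -/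
def slicePoints (i : Fin 15) : Fin 10 → ℤ :=
  Pi.single (slicePointsSupport i).1 1 + Pi.single (slicePointsSupport i).2 1

theorem sliceCommutators_triangular :
    (∀ i j, i < j → commutatorEntry (sliceCommutators i) (sliceTensor (slicePoints j)) = 0) ∧
      ∀ i, commutatorEntry (sliceCommutators i) (sliceTensor (slicePoints i)) ≠ 0 := by
  decide +kernel

theorem forall_isListedSlicePair {B : Matrix (Fin 10) (Fin 10) ℝ}
    (h0 : ∀ p ∈ evenSlicePairs, B p.1 p.2 = 0) (h1 : ∀ p ∈ xySlicePairs, B p.1 p.2 = 0)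
    (h2 : ∀ p ∈ xySlicePairs, B (rotateSlice p.1) (rotateSlice p.2) = 0)
    (h3 : ∀ p ∈ xySlicePairs,
      B (rotateSlice (rotateSlice p.1)) (rotateSlice (rotateSlice p.2)) = 0) :
    ∀ p, IsListedSlicePair p → B p.1 p.2 = 0 := by
  rintro p (hm | hm | hm | hm)
  · exact h0 _ hm
  · exact h1 _ hm
  · simpa using h2 _ hm
  · simpa using h3 _ hm

theorem octForm_yz_eq_zero {B : Matrix (Fin 10) (Fin 10) ℝ} (hB : B ∈ vanishingForms id octSlice)
    (h08 : B 0 8 = 0) (h28 : B 2 8 = 0) (h38 : B 3 8 = 0) :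
    ∀ p ∈ xySlicePairs, B (rotateSlice p.1) (rotateSlice p.2) = 0 :=
  octForm_xy_eq_zero (rotate_mem hB) h08 h28 h38

theorem octForm_zx_eq_zero {B : Matrix (Fin 10) (Fin 10) ℝ} (hB : B ∈ vanishingForms id octSlice)
    (h07 : B 0 7 = 0) (h37 : B 3 7 = 0) (h17 : B 1 7 = 0) :
    ∀ p ∈ xySlicePairs,
      B (rotateSlice (rotateSlice p.1)) (rotateSlice (rotateSlice p.2)) = 0 :=
  octForm_yz_eq_zero (rotate_mem hB) h07 h37 h17

/-- An octahedral form is determined by 15 of its coefficients. -/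
theorem octForm_eq_zero {B : Matrix (Fin 10) (Fin 10) ℝ} (hB : B ∈ vanishingForms id octSlice)
    (h : ∀ i, B (octPos i).1 (octPos i).2 = 0) : B = 0 := by
  have hlist := forall_isListedSlicePair
    (octForm_even_eq_zero hB (h 0) (h 1) (h 2) (h 3) (h 4) (h 5))
    (octForm_xy_eq_zero hB (h 6) (h 7) (h 8)) (octForm_yz_eq_zero hB (h 9) (h 10) (h 11))
    (octForm_zx_eq_zero hB (h 12) (h 13) (h 14))
  ext m n
  rcases isListedSlicePair_or m n with hp | hp
  · exact hlist _ hp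
  · rw [← hB.1.apply m n]
    exact hlist _ hp

/-! ### The quadrics through the odeco variety -/

theorem le_finrank_of_quad_triangular {ι : Type} [Fintype ι] {n : ℕ}
    {W : Submodule ℝ (Matrix ι ι ℝ)} (A : Fin n → Matrix ι ι ℝ) (hA : ∀ i, A i ∈ W)
    (q : Fin n → ι → ℝ) (h0 : ∀ i j, i < j → quad (A i) (q j) = 0)
    (h1 : ∀ i, quad (A i) (q i) ≠ 0) : n ≤ finrank ℝ W := by
  have hli : LinearIndependent ℝ fun i => (⟨A i, hA i⟩ : W) :=
    LinearIndependent.of_comp W.subtype (linearIndependent_of_quad_triangular A q h0 h1)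
  simpa using hli.fintype_card_le_finrank

theorem exists_eq_quarticCoeffs (q : EuclideanSpace ℝ EvenIdx) :
    ∃ T, q = WithLp.toLp 2 (quarticCoeffs T) :=
  ⟨quarticEquiv.symm q.ofLp, by rw [← quarticEquiv_apply, LinearEquiv.apply_symm_apply]⟩

/-- The space of quadratic equations of the odeco variety. -/
abbrev odecoForms : Submodule ℝ (Matrix EvenIdx EvenIdx ℝ) :=
  vanishingForms (fun q : EuclideanSpace ℝ EvenIdx => q.ofLp) odecoVariety

theorem exists_odecoTensors_of_mem {q : EuclideanSpace ℝ EvenIdx} (hq : q ∈ odecoVariety) :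
    ∃ T ∈ odecoTensors, q.ofLp = quarticEquiv (id T) := by
  obtain ⟨T, rfl⟩ := exists_eq_quarticCoeffs q
  exact ⟨T, (mem_odecoVariety_iff T).1 hq, rfl⟩

theorem exists_mem_odecoForms (t : Fin 6 → Fin 3) :
    ∃ A ∈ odecoForms, ∀ T, quad A (quarticCoeffs T) = commutatorEntry t T := by
  obtain ⟨A, hA, h⟩ := exists_vanishingForms_comp quarticEquiv
    (φ := fun q : EuclideanSpace ℝ EvenIdx => q.ofLp)
    (fun q hq => exists_odecoTensors_of_mem hq) (commutatorForm_mem t)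
  exact ⟨A, hA, fun T => by rw [← quad_commutatorForm, ← h, quarticEquiv_apply]⟩

theorem finrank_odecoForms : finrank ℝ odecoForms = 27 := by
  refine le_antisymm (finrank_vanishingForms_le quarticEquiv (ψ := id) (U := odecoTensors)
    (fun T hT => ⟨_, (mem_odecoVariety_iff T).2 hT, rfl⟩) odecoPos
    fun B hB => (isOdecoForm_of_mem hB).eq_zero) ?_
  choose A hA h using exists_mem_odecoForms
  refine le_finrank_of_quad_triangular (fun i => A (basicCommutators i)) (fun i => hA _)
    (fun j => quarticCoeffs fun m => (basicTensors j m : ℝ)) (fun i j hij => ?_) fun i => ?_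
  · rw [h, commutatorEntry_intCast, basicCommutators_triangular.1 i j hij, Int.cast_zero]
  · rw [h, commutatorEntry_intCast]
    exact Int.cast_ne_zero.2 (basicCommutators_triangular.2 i)

theorem mem_odecoVariety_of_forms {q : EuclideanSpace ℝ EvenIdx}
    (h : ∀ A ∈ odecoForms, quad A q.ofLp = 0) : q ∈ odecoVariety := by
  obtain ⟨T, rfl⟩ := exists_eq_quarticCoeffs q
  refine (mem_odecoVariety_iff T).2 (mem_odecoTensors_of_commute fun i j k l a b => ?_)
  obtain ⟨A, hA, hAT⟩ := exists_mem_odecoForms ![i, j, k, l, a, b]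
  have h1 := (hAT T).symm.trans (h A hA)
  rw [commutatorEntry, Finset.sum_sub_distrib, sub_eq_zero] at h1
  exact h1

theorem exists_odeco_quadrics : ∃ A : Fin 27 → Matrix EvenIdx EvenIdx ℝ,
    CutOutIrredundantly (fun q : EuclideanSpace ℝ EvenIdx => q.ofLp) A odecoVariety ∧
      Submodule.span ℝ (Set.range A) = odecoForms :=
  exists_cutOutIrredundantly finrank_odecoForms (fun _ => mem_odecoVariety_of_forms)
    fun _ hB h => eq_zero_of_quad_eq_zero hB fun q => h (WithLp.toLp 2 q)

/-! ### The slice with vanishing second band -/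

/-- The contraction of a quartic tensor over two indices. -/
def contraction (T : Fin 15 → ℝ) (a b : Fin 3) : ℝ := ∑ k, T (quarticIdx a b k k)

theorem contraction_sum_smul {v : Fin 3 → E3} (hv : Orthonormal ℝ v) (lam : Fin 3 → ℝ)
    (a b : Fin 3) : contraction (∑ i, lam i • quarticMonomials (v i).ofLp) a b =
      ∑ p, lam p * (v p a * v p b) := by
  simp only [contraction, sum_smul_quarticMonomials_quarticIdx]
  rw [Finset.sum_comm]
  refine Finset.sum_congr rfl fun p _ => ?_
  have h := orthonormal_iff_sum.1 hv p p
  rw [if_pos rfl] at h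
  calc ∑ k, lam p * (v p a * v p b * v p k * v p k)
      = lam p * (v p a * v p b) * ∑ k, v p k * v p k := by
        rw [Finset.mul_sum]
        exact Finset.sum_congr rfl fun k _ => by ring
    _ = _ := by rw [h, mul_one]

theorem contraction_of_mem_octTensors {T : Fin 15 → ℝ} (hT : T ∈ octTensors) (a b : Fin 3) :
    contraction T a b = if a = b then 1 else 0 := by
  obtain ⟨v, hv, rfl⟩ := hT
  have h := contraction_sum_smul hv 1 a b
  simpa [hv.sum_mul_eq] using h

theorem contraction_eq_of_quarticBand2_eq_zero {T : Fin 15 → ℝ} (h : quarticBand2 T = 0)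
    (a b : Fin 3) : contraction T a b = if a = b then contraction T 0 0 else 0 := by
  have hpi := Real.pi_pos
  have h0 := congrFun h 0
  have h1 := congrFun h 1
  have h2 := congrFun h 2
  have h3 := congrFun h 3
  have h4 := congrFun h 4
  have e15 : √(15 / Real.pi) ≠ 0 := by positivity
  have e5 : √(5 / Real.pi) ≠ 0 := by positivity
  simp only [quarticBand2, Matrix.cons_val, Pi.zero_apply, mul_eq_zero, e15, e5, hpi.ne',
    div_eq_zero_iff, OfNat.ofNat_ne_zero, one_ne_zero, or_self, false_or] at h0 h1 h2 h3 h4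
  fin_cases a <;> fin_cases b <;>
    simp [contraction, Fin.sum_univ_three, quarticIdx] <;> linarith

theorem quarticBand2_eq_zero {T : Fin 15 → ℝ} {c : ℝ}
    (h : ∀ a b, contraction T a b = if a = b then c else 0) : quarticBand2 T = 0 := by
  have e : ∀ a b, T (quarticIdx a b 0 0) + T (quarticIdx a b 1 1) + T (quarticIdx a b 2 2) =
      if a = b then c else 0 := fun a b => by
    rw [← h a b, contraction, Fin.sum_univ_three]
  have h00 := e 0 0
  have h01 := e 0 1
  have h02 := e 0 2
  have h11 := e 1 1
  have h12 := e 1 2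
  have h22 := e 2 2
  simp [quarticIdx] at h00 h01 h02 h11 h12 h22
  have h1 : 2 * (T 4 + T 3 + T 2) - (T 0 + T 5 + T 4) - (T 5 + T 1 + T 3) = 0 := by linarith
  have h2 : (T 0 + T 5 + T 4) - (T 5 + T 1 + T 3) = 0 := by linarith
  have h3 : T 9 + T 10 + T 11 = 0 := by linarith
  ext i
  fin_cases i <;> simp [quarticBand2, h1, h2, h3, h01, h12]

/-- An odeco tensor without second band is a multiple of an octahedral tensor. -/
theorem exists_octTensors_of_quarticBand2_eq_zero {T : Fin 15 → ℝ} (hT : T ∈ odecoTensors)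
    (h : quarticBand2 T = 0) : ∃ t : ℝ, ∃ S ∈ octTensors, T = t • S := by
  obtain ⟨lam, v, hv, rfl⟩ := hT
  have hc := contraction_eq_of_quarticBand2_eq_zero h
  set t := contraction (∑ i, lam i • quarticMonomials (v i).ofLp) 0 0 with ht
  have hlam : ∀ q, lam q = t := fun q => by
    have h1 : ∑ a, ∑ b, v q a * v q b * ∑ p, lam p * (v p a * v p b) = lam q := by
      calc ∑ a, ∑ b, v q a * v q b * ∑ p, lam p * (v p a * v p b)
          = ∑ p, lam p * ((∑ a, v q a * v p a) * ∑ b, v q b * v p b) := by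
            simp only [Fin.sum_univ_three]
            ring
        _ = lam q := by
            simp only [orthonormal_iff_sum.1 hv]
            simp
    have h2 : ∑ a, ∑ b, v q a * v q b * (if a = b then t else 0) = t := by
      have h3 := orthonormal_iff_sum.1 hv q q
      rw [if_pos rfl] at h3
      simp only [mul_ite, mul_zero, Finset.sum_ite_eq, Finset.mem_univ, if_true,
        ← Finset.sum_mul, h3, one_mul]
    rw [← h1, ← h2]
    simp only [← contraction_sum_smul hv, hc]
  exact ⟨t, _, ⟨v, hv, rfl⟩, by simp only [hlam, Finset.smul_sum]⟩

theorem smul_mem_odecoTensors {S : Fin 15 → ℝ} (hS : S ∈ octTensors) (t : ℝ) :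
    t • S ∈ odecoTensors := by
  obtain ⟨v, hv, rfl⟩ := hS
  exact ⟨fun _ => t, v, hv, Finset.smul_sum⟩

/-- Octahedral tensors are determined by their slice coordinates. -/
theorem exists_octSlice_of_mem {T : Fin 15 → ℝ} (hT : T ∈ octTensors) :
    ∃ U ∈ octSlice, T = sliceTensor U := by
  have e : ∀ a b, T (quarticIdx a b 0 0) + T (quarticIdx a b 1 1) + T (quarticIdx a b 2 2) =
      if a = b then 1 else 0 := fun a b => by
    rw [← contraction_of_mem_octTensors hT a b, contraction, Fin.sum_univ_three]
  have h00 := e 0 0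
  have h01 := e 0 1
  have h02 := e 0 2
  have h11 := e 1 1
  have h12 := e 1 2
  have h22 := e 2 2
  simp [quarticIdx] at h00 h01 h02 h11 h12 h22
  have h : T = sliceTensor ![1, T 3, T 4, T 5, T 6, T 7, T 9, T 10, T 12, T 13] := by
    ext m
    fin_cases m <;> simp [sliceTensor] <;> linarith
  exact ⟨_, h ▸ hT, h⟩

theorem contraction_sliceTensor (U : Fin 10 → ℝ) (a b : Fin 3) :
    contraction (sliceTensor U) a b = if a = b then U 0 else 0 := by
  fin_cases a <;> fin_cases b <;>
    simp [contraction, Fin.sum_univ_three, quarticIdx, sliceTensor] <;> ring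

theorem quarticBand0_sliceTensor (U : Fin 10 → ℝ) :
    quarticBand0 (sliceTensor U) = 6 * √Real.pi / 5 * U 0 := by
  simp only [quarticBand0, sliceTensor, Matrix.cons_val]
  ring

theorem apply_zero_of_mem_octSlice {U : Fin 10 → ℝ} (hU : U ∈ octSlice) : U 0 = 1 := by
  have h1 := contraction_of_mem_octTensors hU 0 0
  rwa [contraction_sliceTensor, if_pos rfl, if_pos rfl] at h1

/-- The square of the norm of an octahedral tensor. -/
theorem sum_sq_of_mem_octTensors {T : Fin 15 → ℝ} (hT : T ∈ octTensors) :
    T 0 ^ 2 + T 1 ^ 2 + T 2 ^ 2 + 6 * (T 3 ^ 2 + T 4 ^ 2 + T 5 ^ 2) +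
      4 * (T 6 ^ 2 + T 7 ^ 2 + T 9 ^ 2 + T 10 ^ 2 + T 12 ^ 2 + T 13 ^ 2) +
      12 * (T 8 ^ 2 + T 11 ^ 2 + T 14 ^ 2) = 3 := by
  obtain ⟨v, hv, hTv⟩ := hT
  have h1 : ∑ j, quarticEval T (v j).ofLp = 3 := by
    have h : ∀ j, quarticEval T (v j).ofLp = 1 := fun j => by
      rw [hTv, show (∑ i, quarticMonomials (v i).ofLp) =
        ∑ i, (1 : ℝ) • quarticMonomials (v i).ofLp by simp only [one_smul],
        quarticEval_sum_smul (fun _ => 1)]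
      simp only [orthonormal_iff_sum.1 hv]
      simp
    simp only [h]
    simp
  have hm : ∀ m, T m = ∑ j, quarticMonomials (v j).ofLp m := fun m => by
    rw [hTv, Finset.sum_apply]
  rw [← h1]
  simp only [Fin.sum_univ_three, quarticMonomials] at hm ⊢
  have m0 := hm 0
  have m1 := hm 1
  have m2 := hm 2
  have m3 := hm 3
  have m4 := hm 4
  have m5 := hm 5
  have m6 := hm 6
  have m7 := hm 7
  have m8 := hm 8
  have m9 := hm 9
  have m10 := hm 10
  have m11 := hm 11
  have m12 := hm 12
  have m13 := hm 13
  have m14 := hm 14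
  simp only [Matrix.cons_val] at m0 m1 m2 m3 m4 m5 m6 m7 m8 m9 m10 m11 m12 m13 m14
  simp only [quarticEval]
  linear_combination T 0 * m0 + T 1 * m1 + T 2 * m2 + 6 * T 3 * m3 + 6 * T 4 * m4 +
    6 * T 5 * m5 + 4 * T 6 * m6 + 4 * T 7 * m7 + 12 * T 8 * m8 + 4 * T 9 * m9 +
    4 * T 10 * m10 + 12 * T 11 * m11 + 4 * T 12 * m12 + 4 * T 13 * m13 + 12 * T 14 * m14

theorem sum_sq_quarticBand4_sliceTensor {U : Fin 10 → ℝ} (hU : U ∈ octSlice) :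
    ∑ k, quarticBand4 (sliceTensor U) k ^ 2 = 64 * Real.pi / 525 := by
  have h1 := pi_mul_sqrt_div_pi 1 (by norm_num)
  have h5 := pi_mul_sqrt_div_pi 5 (by norm_num)
  have h35 := pi_mul_sqrt_div_pi 35 (by norm_num)
  have k5 := pi_mul_sqrt_div_two_pi 5 (by norm_num)
  have k35 := pi_mul_sqrt_div_two_pi 35 (by norm_num)
  have hN := sum_sq_of_mem_octTensors hU
  have h0 := apply_zero_of_mem_octSlice hU
  have hT : ∀ T : Fin 15 → ℝ, ∑ k, quarticBand4 T k ^ 2 = (32 / 315) ^ 2 * Real.pi * (9 / 16) *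
      (35 * (T 6 - T 7) ^ 2 + 35 / 2 * (3 * T 14 - T 12) ^ 2 + 5 * (6 * T 8 - T 6 - T 7) ^ 2 +
        5 / 2 * (4 * T 13 - 3 * T 14 - 3 * T 12) ^ 2 +
        1 / 16 * (8 * T 2 + 3 * T 0 + 3 * T 1 - 24 * T 4 - 24 * T 3 + 6 * T 5) ^ 2 +
        5 / 2 * (4 * T 10 - 3 * T 9 - 3 * T 11) ^ 2 +
        5 / 4 * (6 * T 4 - 6 * T 3 - T 0 + T 1) ^ 2 + 35 / 2 * (T 9 - 3 * T 11) ^ 2 +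
        35 / 16 * (T 0 - 6 * T 5 + T 1) ^ 2) := fun T => by
    simp only [quarticBand4]
    generalize √(1 / Real.pi) = r1 at *
    generalize √(5 / Real.pi) = r5 at *
    generalize √(35 / Real.pi) = r35 at *
    generalize √(5 / (2 * Real.pi)) = s5 at *
    generalize √(35 / (2 * Real.pi)) = s35 at *
    simp only [Fin.sum_univ_succ, Fin.sum_univ_zero, Matrix.cons_val, Fin.succ_zero_eq_one]
    simp
    linear_combination (32 / 315) ^ 2 * Real.pi * (9 / 16) *
      (h35 * ((T 6 - T 7) ^ 2 + 1 / 16 * (T 0 - 6 * T 5 + T 1) ^ 2) +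
        k35 * ((3 * T 14 - T 12) ^ 2 + (T 9 - 3 * T 11) ^ 2) +
        h5 * ((6 * T 8 - T 6 - T 7) ^ 2 + 1 / 4 * (6 * T 4 - 6 * T 3 - T 0 + T 1) ^ 2) +
        k5 * ((4 * T 13 - 3 * T 14 - 3 * T 12) ^ 2 + (4 * T 10 - 3 * T 9 - 3 * T 11) ^ 2) +
        h1 * (1 / 16 * (8 * T 2 + 3 * T 0 + 3 * T 1 - 24 * T 4 - 24 * T 3 + 6 * T 5) ^ 2))
  rw [hT]
  simp only [sliceTensor, Matrix.cons_val, h0] at hN ⊢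
  linear_combination (32 / 315) ^ 2 * Real.pi * (315 / 32) * hN

/-! ### The octahedral variety -/

/-- The factor that takes an octahedral tensor to an octahedral frame. -/
noncomputable def frameScale : ℝ := 5 * √21 / (8 * √Real.pi)

theorem frameScale_pos : 0 < frameScale := by
  have := Real.pi_pos
  unfold frameScale
  positivity

theorem sliceConst_pos : 0 < sliceConst := by
  unfold sliceConst
  positivity

theorem frameScale_mul_band0 : frameScale * (6 * √Real.pi / 5) = sliceConst := by
  have : √Real.pi ≠ 0 := by have := Real.pi_pos; positivity
  unfold frameScale sliceConst
  field_simp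
  ring

theorem frameScale_sq : frameScale ^ 2 * (64 * Real.pi / 525) = 1 := by
  have := Real.pi_pos
  rw [frameScale, div_pow, mul_pow, mul_pow, Real.sq_sqrt (by norm_num), Real.sq_sqrt this.le]
  field_simp
  norm_num

theorem evenFun_evenCoeffs (c : ℝ) (f : EuclideanSpace ℝ (Fin 9)) (x : E3) :
    evenFun (evenCoeffs c 0 f) x = c * harm0 + band4Fun f x := by
  simp [evenFun, evenCoeffs, band0, band2, band4, band4Fun]

/-- A point of the slice is given by its coefficients. -/
theorem toLp_quarticCoeffs_eq {T : Fin 15 → ℝ} {c : ℝ} (h0 : quarticBand0 T = c)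
    (h2 : quarticBand2 T = 0) : WithLp.toLp 2 (quarticCoeffs T) =
      evenCoeffs c 0 (WithLp.toLp 2 (quarticBand4 T)) := by
  ext (i | i | i)
  · exact h0
  · exact congrFun h2 i
  · rfl

theorem evenFun_injOn {p q : EuclideanSpace ℝ EvenIdx}
    (h : ∀ x ∈ unitSphere, evenFun p x = evenFun q x) : p = q := by
  obtain ⟨S, rfl⟩ := exists_eq_quarticCoeffs p
  obtain ⟨T, rfl⟩ := exists_eq_quarticCoeffs q
  have h1 : S - T = 0 := eq_zero_of_quarticEval_eq_zero fun x hx => by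
    rw [quarticEval_sub, ← evenFun_quarticCoeffs S hx, ← evenFun_quarticCoeffs T hx, h x hx,
      sub_self]
  rw [sub_eq_zero.1 h1]

theorem quarticBand2_smul (c : ℝ) {T : Fin 15 → ℝ} (h : quarticBand2 T = 0) :
    quarticBand2 (c • T) = 0 := by
  ext i
  have h1 := congrFun (quarticCoeffs.map_smul c T) (Sum.inr (Sum.inl i))
  have h2 : quarticCoeffs T (Sum.inr (Sum.inl i)) = 0 := congrFun h i
  rw [Pi.smul_apply, h2, smul_zero] at h1
  exact h1

/-- Octahedral tensors give points of the slice. -/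
theorem toLp_frameScale_smul {S : Fin 15 → ℝ} (hS : S ∈ octTensors) :
    WithLp.toLp 2 (quarticCoeffs (frameScale • S)) =
      evenCoeffs sliceConst 0 (WithLp.toLp 2 (quarticBand4 (frameScale • S))) := by
  obtain ⟨U, hU, rfl⟩ := exists_octSlice_of_mem hS
  refine toLp_quarticCoeffs_eq ?_ (quarticBand2_smul _
    (quarticBand2_eq_zero (contraction_sliceTensor U)))
  have h1 := congrFun (quarticCoeffs.map_smul frameScale (sliceTensor U)) (Sum.inl 0)
  refine h1.trans ?_
  rw [← frameScale_mul_band0, ← mul_one (6 * √Real.pi / 5), ← apply_zero_of_mem_octSlice hU]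
  exact congrArg _ (quarticBand0_sliceTensor U)

theorem evenCoeffs_canonicalFrame : evenCoeffs sliceConst 0 canonicalFrame =
    WithLp.toLp 2 (quarticCoeffs
      (frameScale • ∑ i, quarticMonomials (EuclideanSpace.single i (1 : ℝ)).ofLp)) := by
  rw [toLp_frameScale_smul ⟨_, EuclideanSpace.orthonormal_single, rfl⟩]
  congr 1
  have hS : ∑ i, quarticMonomials (EuclideanSpace.single i (1 : ℝ)).ofLp =
      ![1, 1, 1, 0, 0, 0, 0, 0, 0, 0, 0, 0, 0, 0, 0] := by
    ext m
    rw [Finset.sum_apply, Fin.sum_univ_three]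
    fin_cases m <;> simp [quarticMonomials]
  rw [hS]
  have hpi := Real.pi_pos
  have hq : Real.pi * (√Real.pi)⁻¹ = √Real.pi := by
    rw [← div_eq_mul_inv, Real.div_sqrt]
  have h12 : √(7 / 12) = √21 / 6 := by
    rw [show (7 / 12 : ℝ) = 21 / 6 ^ 2 by norm_num, Real.sqrt_div (by norm_num),
      Real.sqrt_sq (by norm_num)]
  have h5 : √(5 / 12) = √21 * √35 / 42 := by
    rw [← Real.sqrt_mul (by norm_num), show (21 * 35 : ℝ) = 5 / 12 * 42 ^ 2 by norm_num,
      Real.sqrt_mul (by norm_num), Real.sqrt_sq (by norm_num)]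
    ring
  have hsc : frameScale * √Real.pi = 5 * √21 / 8 := by
    have : √Real.pi ≠ 0 := by positivity
    unfold frameScale
    field_simp
  ext i
  fin_cases i <;> simp [canonicalFrame, quarticBand4, h12, h5]
  · linear_combination -4 / 15 * hsc - 4 / 15 * frameScale * hq
  · linear_combination -4 / 105 * √35 * hsc - 4 / 105 * √35 * frameScale * hq

/-- The frame obtained by a rotation, as a sum of fourth powers of its columns. -/
theorem isBand4Rotation_canonicalFrame_iff (r : Matrix.specialOrthogonalGroup (Fin 3) ℝ)
    (f : EuclideanSpace ℝ (Fin 9)) : IsBand4Rotation r canonicalFrame f ↔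
      evenCoeffs sliceConst 0 f = WithLp.toLp 2 (quarticCoeffs
        (frameScale • ∑ i, quarticMonomials fun j => (r : Matrix (Fin 3) (Fin 3) ℝ) j i)) := by
  set M : Matrix (Fin 3) (Fin 3) ℝ := r.1 with hM
  have hr : M * M.transpose = 1 :=
    (Matrix.mem_orthogonalGroup_iff _ _).1 (Matrix.mem_specialOrthogonalGroup_iff.1 r.2).1
  have hrot : ∀ x : E3, (rotate r⁻¹ x).ofLp = M.transpose.mulVec x.ofLp := fun x => rfl
  have hsphere : ∀ x ∈ unitSphere, rotate r⁻¹ x ∈ unitSphere := fun x hx => by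
    have h1 : ∑ k, x k * x k = 1 := by
      have := sum_sq_of_mem_unitSphere hx
      simpa [Fin.sum_univ_three, ← sq] using this
    have h2 : ∑ k, (rotate r⁻¹ x) k * (rotate r⁻¹ x) k = 1 := by
      have h3 : dotProduct (M.transpose.mulVec x.ofLp) (M.transpose.mulVec x.ofLp) = 1 := by
        rw [Matrix.dotProduct_mulVec, Matrix.vecMul_transpose, Matrix.mulVec_mulVec, hr,
          Matrix.one_mulVec]
        exact h1
      exact h3
    rw [mem_sphere_zero_iff_norm, EuclideanSpace.norm_eq, Real.sqrt_eq_one]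
    simpa [sq] using h2
  have hsum : ∀ (v : Fin 3 → Fin 3 → ℝ) (x : Fin 3 → ℝ),
      quarticEval (frameScale • ∑ i, quarticMonomials (v i)) x =
        frameScale * ∑ i, (∑ j, v i j * x j) ^ 4 := fun v x => by
    have h := quarticEval_sum_smul (fun _ => frameScale) (fun i => WithLp.toLp 2 (v i)) x
    rwa [← Finset.smul_sum, ← Finset.mul_sum] at h
  have key : ∀ x ∈ unitSphere, evenFun (WithLp.toLp 2 (quarticCoeffs
      (frameScale • ∑ i, quarticMonomials fun j => M j i))) x =
        sliceConst * harm0 + band4Fun canonicalFrame (rotate r⁻¹ x) := fun x hx => by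
    rw [← evenFun_evenCoeffs, evenCoeffs_canonicalFrame, evenFun_quarticCoeffs _ hx,
      evenFun_quarticCoeffs _ (hsphere x hx), hsum, hsum, hrot]
    simp [Matrix.mulVec, dotProduct, Fin.sum_univ_three]
  constructor
  · intro h
    refine evenFun_injOn fun x hx => ?_
    rw [key x hx, evenFun_evenCoeffs, h x hx]
  · intro h x hx
    have h1 := evenFun_evenCoeffs sliceConst f x
    rw [h, key x hx] at h1
    linarith

theorem mem_octahedralVariety_iff {f : EuclideanSpace ℝ (Fin 9)} : f ∈ octahedralVariety ↔
    ∃ S ∈ octTensors, evenCoeffs sliceConst 0 f =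
      WithLp.toLp 2 (quarticCoeffs (frameScale • S)) := by
  constructor
  · rintro ⟨r, h⟩
    refine ⟨_, ⟨fun i => WithLp.toLp 2 fun j => (r : Matrix (Fin 3) (Fin 3) ℝ) j i, ?_, rfl⟩,
      (isBand4Rotation_canonicalFrame_iff r f).1 h⟩
    rw [orthonormal_iff_sum]
    intro i j
    have h1 := congrFun (congrFun ((Matrix.mem_orthogonalGroup_iff' _ _).1
      (Matrix.mem_specialOrthogonalGroup_iff.1 r.2).1) i) j
    rwa [Matrix.mul_apply, Matrix.one_apply] at h1
  · rintro ⟨_, ⟨v, hv, rfl⟩, h⟩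
    let M : Matrix (Fin 3) (Fin 3) ℝ := Matrix.of fun j i => v i j
    have hM : M.transpose * M = 1 := by
      ext i j
      simpa [M, Matrix.mul_apply, Matrix.one_apply] using orthonormal_iff_sum.1 hv i j
    have hdet : M.det * M.det = 1 := by
      have h1 := congrArg Matrix.det hM
      rwa [Matrix.det_mul, Matrix.det_transpose, Matrix.det_one] at h1
    rcases mul_self_eq_one_iff.1 hdet with hd | hd
    · refine ⟨⟨M, Matrix.mem_specialOrthogonalGroup_iff.2
        ⟨(Matrix.mem_orthogonalGroup_iff' _ _).2 hM, hd⟩⟩,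
        (isBand4Rotation_canonicalFrame_iff _ f).2 h⟩
    · refine ⟨⟨-M, Matrix.mem_specialOrthogonalGroup_iff.2
        ⟨(Matrix.mem_orthogonalGroup_iff' _ _).2 ?_, ?_⟩⟩,
        (isBand4Rotation_canonicalFrame_iff _ f).2 (h.trans ?_)⟩
      · rw [Matrix.transpose_neg, neg_mul_neg, hM]
      · rw [Matrix.det_neg, hd]
        norm_num
      · simp only [← quarticMonomials_neg (v _).ofLp]
        rfl

theorem mem_odecoVariety_and_band2_eq_zero_iff {q : EuclideanSpace ℝ EvenIdx} :
    (q ∈ odecoVariety ∧ band2 q = 0) ↔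
      ∃ t : ℝ, ∃ f ∈ octahedralVariety, q = t • evenCoeffs sliceConst 0 f := by
  constructor
  · rintro ⟨hq, h2⟩
    obtain ⟨T, rfl⟩ := exists_eq_quarticCoeffs q
    rw [band2_quarticCoeffs] at h2
    obtain ⟨t, S, hS, rfl⟩ := exists_octTensors_of_quarticBand2_eq_zero
      ((mem_odecoVariety_iff T).1 hq) (congrArg WithLp.ofLp h2)
    refine ⟨t * frameScale⁻¹, _, mem_octahedralVariety_iff.2
      ⟨S, hS, (toLp_frameScale_smul hS).symm⟩, ?_⟩
    rw [← toLp_frameScale_smul hS, ← WithLp.toLp_smul, ← map_smul, smul_smul,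
      inv_mul_cancel_right₀ frameScale_pos.ne']
  · rintro ⟨t, f, hf, rfl⟩
    obtain ⟨S, hS, h⟩ := mem_octahedralVariety_iff.1 hf
    constructor
    · rw [h, ← WithLp.toLp_smul, ← map_smul, smul_smul, mem_odecoVariety_iff]
      exact smul_mem_odecoTensors hS _
    · ext i
      simp [band2, evenCoeffs]

theorem norm_of_mem_octahedralVariety {f : EuclideanSpace ℝ (Fin 9)}
    (hf : f ∈ octahedralVariety) : ‖f‖ = 1 := by
  obtain ⟨S, hS, h⟩ := mem_octahedralVariety_iff.1 hf
  obtain ⟨U, hU, rfl⟩ := exists_octSlice_of_mem hS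
  have hk : ∀ k, f k = frameScale * quarticBand4 (sliceTensor U) k := fun k => by
    have h1 := congrArg (fun q : EuclideanSpace ℝ EvenIdx => q (Sum.inr (Sum.inr k))) h
    exact h1.trans (congrFun (quarticCoeffs.map_smul frameScale (sliceTensor U))
      (Sum.inr (Sum.inr k)))
  rw [EuclideanSpace.norm_eq, Real.sqrt_eq_one]
  simp only [Real.norm_eq_abs, sq_abs, hk, mul_pow]
  rw [← Finset.mul_sum, sum_sq_quarticBand4_sliceTensor hU, frameScale_sq]

theorem norm_band4_eq_one_iff {q : EuclideanSpace ℝ EvenIdx} (hq : q ∈ odecoVariety)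
    (h2 : band2 q = 0) : ‖band4 q‖ = 1 ↔ |band0 q| = sliceConst := by
  obtain ⟨t, f, hf, rfl⟩ := mem_odecoVariety_and_band2_eq_zero_iff.1 ⟨hq, h2⟩
  have h4 : band4 (t • evenCoeffs sliceConst 0 f) = t • f := by
    ext i
    simp [band4, evenCoeffs]
  have h0 : band0 (t • evenCoeffs sliceConst 0 f) = t * sliceConst := by
    simp [band0, evenCoeffs]
  rw [h4, h0, norm_smul, norm_of_mem_octahedralVariety hf, abs_mul, abs_of_pos sliceConst_pos,
    mul_one, Real.norm_eq_abs]
  constructor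
  · intro h
    rw [h, one_mul]
  · intro h
    exact mul_right_cancel₀ sliceConst_pos.ne' (h.trans (one_mul _).symm)

theorem octahedralVariety_eq :
    octahedralVariety = {f | evenCoeffs sliceConst 0 f ∈ odecoVariety} := by
  ext f
  constructor
  · intro hf
    exact (mem_odecoVariety_and_band2_eq_zero_iff.2 ⟨1, f, hf, (one_smul _ _).symm⟩).1
  · intro hf
    obtain ⟨t, g, hg, h⟩ := mem_odecoVariety_and_band2_eq_zero_iff.1 ⟨hf, by ext i; simp [band2, evenCoeffs]⟩
    have h0 : sliceConst = t * sliceConst :=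
      congrArg (fun q : EuclideanSpace ℝ EvenIdx => q (Sum.inl 0)) h
    have ht : t = 1 := (mul_right_cancel₀ sliceConst_pos.ne' ((one_mul _).trans h0)).symm
    have hfg : f = g := by
      ext k
      have h1 := congrArg (fun q : EuclideanSpace ℝ EvenIdx => q (Sum.inr (Sum.inr k))) h
      simpa [evenCoeffs, ht] using h1
    rwa [hfg]

/-! ### The quadratic equations of the octahedral variety -/

/-- The space of inhomogeneous quadratic equations of the octahedral variety. -/
abbrev octahedralForms : Submodule ℝ (Matrix (Fin 1 ⊕ Fin 9) (Fin 1 ⊕ Fin 9) ℝ) :=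
  vanishingForms withOne octahedralVariety

theorem eq_zero_of_quad_withOne_eq_zero {B : Matrix (Fin 1 ⊕ Fin 9) (Fin 1 ⊕ Fin 9) ℝ}
    (hB : B.IsSymm) (h : ∀ f, quad B (withOne f) = 0) : B = 0 := by
  refine eq_zero_of_quad_eq_zero hB fun q => ?_
  set p : Fin 1 ⊕ Fin 9 → ℝ := withOne 0 with hp
  let g : Fin 1 ⊕ Fin 9 → ℝ := Sum.elim (fun _ => 0) fun i => q (Sum.inr i)
  have hsmul : ∀ (c : ℝ) (y : Fin 1 ⊕ Fin 9 → ℝ), quad B (c • y) = c ^ 2 * quad B y :=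
    fun c y => by
      simp only [quad, Matrix.mulVec_smul, dotProduct_smul, smul_dotProduct, smul_eq_mul]
      ring
  have hw : ∀ c : ℝ, quad B (p + c • g) = 0 := fun c => by
    rw [← h (WithLp.toLp 2 fun i => c * q (Sum.inr i))]
    congr 1
    ext (i | i) <;> simp [hp, withOne, g]
  have hq : q = q (Sum.inl 0) • p + g := by
    ext (i | i)
    · simp [hp, withOne, g, Subsingleton.elim i 0]
    · simp [hp, withOne, g]
  have h0 := hw 0
  have h1 := hw 1
  have h2 := hw (-1)
  rw [quad_add B hB, hsmul, Matrix.mulVec_smul, dotProduct_smul, smul_eq_mul] at h0 h1 h2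
  rw [hq, quad_add B hB, hsmul, smul_dotProduct, smul_eq_mul]
  linear_combination (q (Sum.inl 0) ^ 2 - 1) * h0 + (1 + q (Sum.inl 0)) / 2 * h1 +
    (1 - q (Sum.inl 0)) / 2 * h2

theorem sliceMatrix_mulVec_withOne (f : EuclideanSpace ℝ (Fin 9)) :
    sliceMatrix.mulVec (withOne f) = (evenCoeffs sliceConst 0 f).ofLp := by
  ext (i | i | i) <;>
    simp [sliceMatrix, Matrix.mulVec, dotProduct, withOne, evenCoeffs]

theorem transpose_mul_mul_mem_octahedralForms {A : Matrix EvenIdx EvenIdx ℝ}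
    (hA : A ∈ odecoForms) : sliceMatrix.transpose * A * sliceMatrix ∈ octahedralForms := by
  refine ⟨?_, fun f hf => ?_⟩
  · simp [Matrix.IsSymm, Matrix.transpose_mul, hA.1.eq, Matrix.mul_assoc]
  · rw [octahedralVariety_eq] at hf
    rw [quad_transpose_mul_mul, sliceMatrix_mulVec_withOne]
    exact hA.2 _ hf

/-- Restriction of a quadratic form to the normalized slice. -/
noncomputable def sliceRestriction : Matrix EvenIdx EvenIdx ℝ →ₗ[ℝ]
    Matrix (Fin 1 ⊕ Fin 9) (Fin 1 ⊕ Fin 9) ℝ where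
  toFun A := sliceMatrix.transpose * A * sliceMatrix
  map_add' A B := by rw [Matrix.mul_add, Matrix.add_mul]
  map_smul' c A := by simp

theorem mem_octahedralVariety_of_forms {f : EuclideanSpace ℝ (Fin 9)}
    (h : ∀ B ∈ octahedralForms, quad B (withOne f) = 0) : f ∈ octahedralVariety := by
  rw [octahedralVariety_eq]
  refine mem_odecoVariety_of_forms fun A hA => ?_
  rw [← sliceMatrix_mulVec_withOne, ← quad_transpose_mul_mul]
  exact h _ (transpose_mul_mul_mem_octahedralForms hA)

/-- The tensor with given slice coordinates, as a linear map. -/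
def sliceTensorLinear : (Fin 10 → ℝ) →ₗ[ℝ] (Fin 15 → ℝ) where
  toFun := sliceTensor
  map_add' U V := by
    ext m
    fin_cases m <;> simp [sliceTensor] <;> ring
  map_smul' c U := by
    ext m
    fin_cases m <;> simp [sliceTensor] <;> ring

/-- The coordinates `(1, f)` in terms of slice coordinates. -/
noncomputable def sliceCoeffs : (Fin 10 → ℝ) →ₗ[ℝ] (Fin 1 ⊕ Fin 9 → ℝ) where
  toFun U := Sum.elim (fun _ => U 0) fun k => quarticCoeffs (frameScale • sliceTensorLinear U)
    (Sum.inr (Sum.inr k))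
  map_add' U V := by
    ext (i | i)
    · rfl
    · simp
  map_smul' c U := by
    ext (i | i)
    · rfl
    · simp
      ring

theorem sliceMatrix_mulVec_sliceCoeffs (U : Fin 10 → ℝ) :
    sliceMatrix.mulVec (sliceCoeffs U) = quarticCoeffs (frameScale • sliceTensor U) := by
  have h2 := quarticBand2_smul frameScale (quarticBand2_eq_zero (contraction_sliceTensor U))
  have h0 := congrFun (quarticCoeffs.map_smul frameScale (sliceTensor U)) (Sum.inl 0)
  have h0' : quarticCoeffs (sliceTensor U) (Sum.inl 0) = 6 * √Real.pi / 5 * U 0 :=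
    quarticBand0_sliceTensor U
  rw [Pi.smul_apply, h0', smul_eq_mul, ← mul_assoc, frameScale_mul_band0] at h0
  ext (i | i | i)
  · rw [Subsingleton.elim i 0, h0]
    simp [sliceMatrix, Matrix.mulVec, dotProduct, sliceCoeffs]
  · refine Eq.trans ?_ (congrFun h2 i).symm
    simp [sliceMatrix, Matrix.mulVec, dotProduct]
  · simp [sliceMatrix, Matrix.mulVec, dotProduct, sliceCoeffs, sliceTensorLinear]

theorem sliceTensor_injective : Function.Injective (sliceTensor (R := ℝ)) := by
  intro U V h
  have e := fun m => congrFun h m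
  simp only [Fin.forall_fin_succ, sliceTensor] at e
  simp at e
  ext m
  fin_cases m <;> simp <;> linarith

theorem sliceCoeffs_injective : Function.Injective sliceCoeffs := by
  intro U V h
  have h1 := sliceMatrix_mulVec_sliceCoeffs U
  rw [h, sliceMatrix_mulVec_sliceCoeffs] at h1
  exact sliceTensor_injective (smul_right_injective _ frameScale_pos.ne'
    (quarticCoeffs_injective h1)).symm

/-- Slice coordinates correspond to the coordinates `(1, f)`. -/
noncomputable def sliceEquiv : (Fin 10 → ℝ) ≃ₗ[ℝ] (Fin 1 ⊕ Fin 9 → ℝ) :=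
  LinearEquiv.ofInjectiveOfFinrankEq sliceCoeffs sliceCoeffs_injective (by simp)

theorem exists_withOne_eq {U : Fin 10 → ℝ} (hU : U ∈ octSlice) :
    ∃ f ∈ octahedralVariety, withOne f = sliceEquiv (id U) := by
  refine ⟨_, mem_octahedralVariety_iff.2 ⟨_, hU, (toLp_frameScale_smul hU).symm⟩, ?_⟩
  ext (i | i)
  · exact (apply_zero_of_mem_octSlice hU).symm
  · rfl

theorem finrank_octahedralForms_le : finrank ℝ octahedralForms ≤ 15 :=
  finrank_vanishingForms_le sliceEquiv (ψ := id) (fun _ hU => exists_withOne_eq hU) octPos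
    fun _ hB => octForm_eq_zero hB

theorem le_finrank_map_sliceRestriction : 15 ≤ finrank ℝ (odecoForms.map sliceRestriction) := by
  choose A hA h using exists_mem_odecoForms
  have hq : ∀ i j, quad (sliceRestriction (A (sliceCommutators i)))
      (sliceCoeffs fun m => (slicePoints j m : ℝ)) = frameScale ^ 2 *
        ((commutatorEntry (sliceCommutators i) (sliceTensor (slicePoints j)) : ℤ) : ℝ) := by
    intro i j
    have hcast : sliceTensor (fun m => (slicePoints j m : ℝ)) =
        fun m => ((sliceTensor (slicePoints j) m : ℤ) : ℝ) := by
      ext m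
      fin_cases m <;> simp [sliceTensor]
    refine (quad_transpose_mul_mul sliceMatrix (A (sliceCommutators i)) _).trans ?_
    rw [sliceMatrix_mulVec_sliceCoeffs, h, hcast, ← commutatorEntry_intCast]
    simp only [commutatorEntry, Pi.smul_apply, smul_eq_mul, Finset.mul_sum]
    exact Finset.sum_congr rfl fun s _ => by ring
  refine le_finrank_of_quad_triangular (fun i => sliceRestriction (A (sliceCommutators i)))
    (fun i => ⟨_, hA _, rfl⟩) (fun j => sliceCoeffs fun m => (slicePoints j m : ℝ))
    (fun i j hij => ?_) fun i => ?_
  · rw [hq, sliceCommutators_triangular.1 i j hij, Int.cast_zero, mul_zero]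
  · rw [hq]
    exact mul_ne_zero (pow_ne_zero _ frameScale_pos.ne')
      (Int.cast_ne_zero.2 (sliceCommutators_triangular.2 i))

theorem map_sliceRestriction_le : odecoForms.map sliceRestriction ≤ octahedralForms := by
  rintro _ ⟨A, hA, rfl⟩
  exact transpose_mul_mul_mem_octahedralForms hA

theorem finrank_octahedralForms : finrank ℝ octahedralForms = 15 :=
  le_antisymm finrank_octahedralForms_le
    (le_finrank_map_sliceRestriction.trans (Submodule.finrank_mono map_sliceRestriction_le))

/-- Every equation of the octahedral variety is the restriction of an odeco quadric. -/
theorem map_sliceRestriction : odecoForms.map sliceRestriction = octahedralForms :=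
  Submodule.eq_of_le_of_finrank_le map_sliceRestriction_le
    (finrank_octahedralForms_le.trans le_finrank_map_sliceRestriction)

theorem exists_octahedral_equations :
    ∃ P : Fin 15 → Matrix (Fin 1 ⊕ Fin 9) (Fin 1 ⊕ Fin 9) ℝ,
      CutOutIrredundantly withOne P octahedralVariety ∧
        Submodule.span ℝ (Set.range P) = octahedralForms :=
  exists_cutOutIrredundantly finrank_octahedralForms (fun _ => mem_octahedralVariety_of_forms)
    fun _ => eq_zero_of_quad_withOne_eq_zero

theorem mainTheorem2 :
    ∃ (A : Fin 27 → Matrix EvenIdx EvenIdx ℝ)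
      (P : Fin 15 → Matrix (Fin 1 ⊕ Fin 9) (Fin 1 ⊕ Fin 9) ℝ),
      -- the odeco variety is cut out by 27 quadrics
      CutOutIrredundantly (fun q : EuclideanSpace ℝ EvenIdx => q.ofLp) A odecoVariety ∧
      -- the slice with vanishing second band consists of the multiples of octahedral frames
      {q | q ∈ odecoVariety ∧ band2 q = 0} =
        {q | ∃ t : ℝ, ∃ f ∈ octahedralVariety, q = t • evenCoeffs sliceConst 0 f} ∧
      -- normalization of the slice
      (∀ q ∈ odecoVariety, band2 q = 0 → (‖band4 q‖ = 1 ↔ |band0 q| = sliceConst)) ∧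
      -- the octahedral variety is the normalized slice
      octahedralVariety = {f | evenCoeffs sliceConst 0 f ∈ odecoVariety} ∧
      -- the octahedral variety is cut out by 15 inhomogeneous quadratic equations
      CutOutIrredundantly withOne P octahedralVariety ∧
      -- they arise by restricting the 27 quadrics to the normalized slice
      Submodule.span ℝ (Set.range P) =
        Submodule.span ℝ (Set.range fun i => sliceMatrix.transpose * A i * sliceMatrix) := by
  obtain ⟨A, hA, hspanA⟩ := exists_odeco_quadrics
  obtain ⟨P, hP, hspanP⟩ := exists_octahedral_equations
  refine ⟨A, P, hA, Set.ext fun q => mem_odecoVariety_and_band2_eq_zero_iff,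
    fun q hq h2 => norm_band4_eq_one_iff hq h2, octahedralVariety_eq, hP, ?_⟩
  rw [hspanP, ← map_sliceRestriction, ← hspanA, Submodule.map_span, ← Set.range_comp]
  rfl
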